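/- **Setting.** Let $K,N$ be integers with $N\ge K\ge 3$. A library consists of $N$ independent files $F_1,\dots,F_N$, each of $B$ independent uniform bits. Entropies $H$ and mutual informations $I$ are in bits. There are $K$ users; the demand vector $\mathbf D=(D_1,\dots,D_K)\in[N]^K$ has a fixed law that gives positive probability to every vector in $[N]^K$. A *scheme* works as follows. * *Placement.* User $k$ stores $Z_k=(\mathcal M(C_k),C_k)$, where $\mathcal M(C_k)$ (the metadata) takes finitely many values and describes how the cached content $C_k$ is composed from the files, so that $C_k$ is a function of $\mathcal M(C_k)$ and the library. The metadata of all users may be random and jointly distributed; they are independent of the demands and of the files. The placement is *uncoded*: for each value of $\mathcal M(C_k)$, $C_k$ is a list of bits copied from the files. * *Delivery.* A trusted server, which knows $\mathbf D$ and all cache metadata but does not have access to the library, chooses, possibly at random, metadata $\mathcal M(P_k)$ (with finitely many values) for every user $k$, which describe how the packets $P_k$ are composed from the files, so that $P_k$ is a function of $\mathcal M(P_k)$ and the library. User $k$ broadcasts $X_k=(\mathcal M(P_k),P_k)$. Write $\mathbf X=(X_1,\dots,X_K)$. For a cache size $M$, a load $R\in\mathbb R$ is *achievable* under uncoded placement and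 privacy against colluding users if there are $\epsilon_B\ge 0$ with $\lim_{B\to\infty}\epsilon_B=0$ such that for all sufficiently large $B$ there is a scheme with uncoded placement for which, for all $k\in[K]$, $$H(Z_k)\le B(M+\epsilon_B),\qquad H(X_k\mid \mathcal M(P_k),Z_k)=0,\qquad H(F_{D_k}\mid \mathbf X,Z_k,D_k)\le B\epsilon_B,$$ $$I\big(\mathbf D;\mathbf X,\{Z_k\}_{k\in S}\mid \{D_k\}_{k\in S}\big)=0\ \text{ for all } \emptyset\ne S\subseteq[K],\qquad \sum_{k\in[K]}H(X_k)\le B(R+\epsilon_B).$$ Let $R^\star_{\mathrm{u,c}}(M)$ be the infimum of the achievable loads. **Theorem.** Let $M=\frac NK+\frac{2y}{K}$ with $y\in[0,N/2]$. Then, for every integer $h$ with $0\le h\le\lfloor 2N/K-3\rfloor$ (there are such $h$ only if $N/K\ge 3/2$), $$R^\star_{\mathrm{u,c}}(M)\ \ge\ \frac{\lfloor K/2\rfloor}{\lceil K/2\rceil}\,\frac{\lfloor 2N/K\rfloor}{2N/K}\left(N-2y-\frac{4y+(N-\frac K2)h}{h+2}+\frac{h^2(N-\frac K2)-N(\frac{2N}{K}-3)+h(N+\frac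 K2)}{(h+1)(h+2)}\cdot\frac{2y}{N}\right),$$ and moreover $$R^\star_{\mathrm{u,c}}(M)\ \ge\ \frac{\lfloor K/2\rfloor}{\lceil K/2\rceil}\,K\left(1-\frac{3y}{N}\right),\qquad R^\star_{\mathrm{u,c}}(M)\ \ge\ \frac{\lfloor K/2\rfloor}{\lceil K/2\rceil}\,K\left(\frac12-\frac yN\right).$$ -/

import Mathlib

/-! Device-to-device coded caching with private demands and a trusted server. -/

noncomputable section

namespace D2D

open Filter Topology

/-! ### Shannon information measures (in bits) on a finite probability space

`P : Ω → ℝ` is the probability mass function of the finite sample space `Ω`; random variables are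
functions on `Ω`, with values in arbitrary types. -/

section Information

variable {Ω : Type*} [Fintype Ω] {α β γ : Type*}

open Classical in
/-- `H(X) = - ∑_ω P(ω) log₂ Pr[X = X(ω)] = - ∑_x Pr[X = x] log₂ Pr[X = x]`. -/
def entropy (P : Ω → ℝ) (X : Ω → α) : ℝ :=
  -∑ ω, P ω * Real.logb 2 (∑ ω', if X ω' = X ω then P ω' else 0)

/-- `H(X | Y) = H(X, Y) - H(Y)`. -/
def condEntropy (P : Ω → ℝ) (X : Ω → α) (Y : Ω → β) : ℝ :=
  entropy P (fun ω => (X ω, Y ω)) - entropy P Y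

/-- `I(X; Y | Z) = H(X | Z) - H(X | Y, Z)`. -/
def condMutualInfo (P : Ω → ℝ) (X : Ω → α) (Y : Ω → β) (Z : Ω → γ) : ℝ :=
  condEntropy P X Z - condEntropy P X (fun ω => (Y ω, Z ω))

end Information

/-- A library: `N` files of `B` bits each. -/
abbrev Library (N B : ℕ) : Type := Fin N → Fin B → Bool

/-- A demand vector: user `k` demands the file with index `d k`. -/
abbrev Demand (K N : ℕ) : Type := Fin K → Fin N

/-- A caching scheme for `K` users and `N` files of `B` bits, before any constraint is imposed. -/
structure Scheme (K N B : ℕ) where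
  /-- the alphabet of the metadata of the cache of user `k` -/
  CacheMeta : Fin K → Type
  /-- the alphabet of the metadata of the packets that user `k` broadcasts -/
  PacketMeta : Fin K → Type
  [fintypeCacheMeta : ∀ k, Fintype (CacheMeta k)]
  [fintypePacketMeta : ∀ k, Fintype (PacketMeta k)]
  /-- the cached content of user `k`: metadata describe how it is composed from the files -/
  content : ∀ k, CacheMeta k → Library N B → List Bool
  /-- the packets (payload) of user `k`: metadata describe how they are composed from the files -/
  payload : ∀ k, PacketMeta k → Library N B → List Bool
  /-- the joint law of the cache metadata of all users; neither demands nor files are used -/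
  placement : PMF (∀ k, CacheMeta k)
  /-- the (randomized) rule by which the trusted server, who knows the demands and the cache
  metadata but has no access to the library, chooses the packet metadata of all users -/
  delivery : Demand K N → (∀ k, CacheMeta k) → PMF (∀ k, PacketMeta k)

namespace Scheme

attribute [instance] Scheme.fintypeCacheMeta Scheme.fintypePacketMeta

variable {K N B : ℕ} (s : Scheme K N B)

/-- An outcome: demands, library, cache metadata of all users, packet metadata of all users. -/
abbrev Outcome : Type :=
  Demand K N × Library N B × (∀ k, s.CacheMeta k) × (∀ k, s.PacketMeta k)

/-- The joint probability mass function when the demand vector has law `PD`. The library is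
uniform (all bits are independent and fair) and independent of demands and metadata; the cache
metadata are independent of the demands; the packet metadata follow the rule of the server. -/
def prob (PD : PMF (Demand K N)) (ω : s.Outcome) : ℝ :=
  (PD ω.1).toReal * ((1 / 2 : ℝ) ^ (N * B)) * (s.placement ω.2.2.1).toReal *
    (s.delivery ω.1 ω.2.2.1 ω.2.2.2).toReal

/-- The demand vector `D`. -/
def D (ω : s.Outcome) : Demand K N := ω.1

/-- The file `F_n`. -/
def F (n : Fin N) (ω : s.Outcome) : Fin B → Bool := ω.2.1 n

/-- The metadata of the packets of user `k`. -/
def packetMeta (k : Fin K) (ω : s.Outcome) : s.PacketMeta k := ω.2.2.2 k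

/-- The cache `Z_k` of user `k`: metadata and content. -/
def Z (k : Fin K) (ω : s.Outcome) : s.CacheMeta k × List Bool :=
  (ω.2.2.1 k, s.content k (ω.2.2.1 k) ω.2.1)

/-- The signal `X_k` broadcast by user `k`: metadata and packets. -/
def X (k : Fin K) (ω : s.Outcome) : s.PacketMeta k × List Bool :=
  (ω.2.2.2 k, s.payload k (ω.2.2.2 k) ω.2.1)

/-- All broadcast signals. -/
def allX (ω : s.Outcome) : ∀ k, s.PacketMeta k × List Bool := fun k => s.X k ω

/-- Uncoded cache placement: each user directly copies some bits of the files. -/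
def IsUncoded : Prop :=
  ∀ (k : Fin K) (c : s.CacheMeta k), ∃ positions : List (Fin N × Fin B),
    ∀ f : Library N B, s.content k c f = positions.map (fun p => f p.1 p.2)

/-- Cache size constraint. -/
def CacheSize (PD : PMF (Demand K N)) (M ε : ℝ) : Prop :=
  ∀ k, entropy (s.prob PD) (s.Z k) ≤ B * (M + ε)

/-- Encoding constraint: user `k` computes its signal from its cache and its packet metadata. -/
def Encoding (PD : PMF (Demand K N)) : Prop :=
  ∀ k, condEntropy (s.prob PD) (s.X k) (fun ω => (s.packetMeta k ω, s.Z k ω)) = 0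

/-- Decoding constraint: user `k` recovers the file it demands. -/
def Decoding (PD : PMF (Demand K N)) (ε : ℝ) : Prop :=
  ∀ k, condEntropy (s.prob PD) (fun ω => s.F (s.D ω k) ω)
    (fun ω => (s.allX ω, s.Z k ω, s.D ω k)) ≤ B * ε

/-- Privacy against colluding users: the signals together with the caches of any nonempty set `S`
of users reveal nothing about the demand vector beyond the demands of the users in `S`. -/
def CollusionPrivacy (PD : PMF (Demand K N)) : Prop :=
  ∀ S : Finset (Fin K), S.Nonempty →
    condMutualInfo (s.prob PD) s.D
      (fun ω => (s.allX ω, fun k : S => s.Z k ω))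
      (fun ω => fun k : S => s.D ω k) = 0

/-- Load constraint. -/
def Load (PD : PMF (Demand K N)) (R ε : ℝ) : Prop :=
  ∑ k, entropy (s.prob PD) (s.X k) ≤ B * (R + ε)

end Scheme

/-- The load `R` is achievable with cache size `M`, under uncoded cache placement and privacy
against colluding users, when the demand vector has law `PD`. -/
def AchievableUC (K N : ℕ) (PD : PMF (Demand K N)) (M R : ℝ) : Prop :=
  ∃ ε : ℕ → ℝ, (∀ B, 0 ≤ ε B) ∧ Tendsto ε atTop (𝓝 0) ∧
    ∀ᶠ B in atTop, ∃ s : Scheme K N B,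
      s.IsUncoded ∧ s.CacheSize PD M (ε B) ∧ s.Encoding PD ∧ s.Decoding PD (ε B) ∧
        s.CollusionPrivacy PD ∧ s.Load PD R (ε B)

/-- The optimal load `R*_{u,c}(M)`: the infimum of the achievable loads (`⊤` if there is none). -/
def optimalLoadUC (K N : ℕ) (PD : PMF (Demand K N)) (M : ℝ) : EReal :=
  sInf {r : EReal | ∃ R : ℝ, AchievableUC K N PD M R ∧ r = (R : EReal)}

end D2D

end

/-!
Privacy against single users already forces the bounds. Since every demand vector has positive
probability and any two of them are linked by a third one that agrees with each at one user, the law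
of the packet metadata does not depend on the demands. So fix one value of the packet metadata: it
serves `n` demand vectors at once, which ask for disjoint blocks of `m = ⌊K / 2⌋` files, each block
with its own realization of the caches.

Split the users into two groups such that each group demands the whole block. The signals of one
group together with the caches of the other one determine the block. Decode the `n` blocks in a
random order: a demanded bit that is cached for `x` of the other blocks counts only if its block
comes first, hence with weight `1 / (x + 1)`, which is at least an affine function of `x` that is
nearly tight at `x = h` and `x = h + 1`. A signal depends only on bits that are cached in every
realization, so the overlaps involve only bits that are cached in both groups, and on average there
are at most `(K * M - N) * B = 2 * y * B` of them. Averaging over cyclic shifts of the blocks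
distributes these bits evenly over the library.
-/

noncomputable section

namespace D2D

open Finset
open scoped Function

/-! ### Shannon inequalities -/

section Toolkit

variable {Ω : Type*} [Fintype Ω] {α β γ δ : Type*} {P : Ω → ℝ}

open Classical in
/-- The probability that `X` takes the value `x`. -/
def mass (P : Ω → ℝ) (X : Ω → α) (x : α) : ℝ := ∑ ω with X ω = x, P ω

theorem entropy_eq_neg_sum_mass (P : Ω → ℝ) (X : Ω → α) :
    entropy P X = -∑ ω, P ω * Real.logb 2 (mass P X (X ω)) := by
  simp only [entropy, mass, sum_filter]

theorem mass_nonneg (hP : ∀ ω, 0 ≤ P ω) (X : Ω → α) (x : α) : 0 ≤ mass P X x :=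
  sum_nonneg fun ω _ => hP ω

theorem mass_pos (hP : ∀ ω, 0 ≤ P ω) (X : Ω → α) {ω : Ω} (hω : P ω ≠ 0) : 0 < mass P X (X ω) :=
  sum_pos' (fun ω' _ => hP ω') ⟨ω, by simp, (hP ω).lt_of_ne' hω⟩

theorem mass_mono (hP : ∀ ω, 0 ≤ P ω) {X : Ω → α} {Y : Ω → β} {x : α} {y : β}
    (h : ∀ ω, X ω = x → Y ω = y) : mass P X x ≤ mass P Y y := by
  classical
  exact sum_le_sum_of_subset_of_nonneg (monotone_filter_right _ fun ω _ => h ω) fun ω _ _ => hP ω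

theorem mass_congr {X : Ω → α} {Y : Ω → β} {x : α} {y : β} (h : ∀ ω, X ω = x ↔ Y ω = y) :
    mass P X x = mass P Y y := by
  classical
  exact sum_congr (filter_congr fun ω _ => h ω) fun _ _ => rfl

theorem mass_eq_zero {X : Ω → α} {x : α} (h : ∀ ω, X ω ≠ x) : mass P X x = 0 := by
  simp [mass, h]

theorem mass_const (P : Ω → ℝ) (c : α) : mass P (fun _ => c) c = ∑ ω, P ω := by
  simp [mass]

theorem sum_mul_comp_eq_sum_mass_mul (P : Ω → ℝ) (X : Ω → α) {S : Finset α} (hS : ∀ ω, X ω ∈ S)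
    (g : α → ℝ) : ∑ ω, P ω * g (X ω) = ∑ x ∈ S, mass P X x * g x := by
  classical
  rw [← sum_fiberwise_of_maps_to fun ω _ => hS ω]
  refine sum_congr rfl fun x _ => ?_
  rw [mass, sum_mul]
  exact sum_congr (by congr) fun ω hω => by rw [(mem_filter.1 hω).2]

theorem sum_mass_prodMk (P : Ω → ℝ) (X : Ω → α) (Y : Ω → β) {S : Finset α} (hS : ∀ ω, X ω ∈ S)
    (y : β) : ∑ x ∈ S, mass P (fun ω => (X ω, Y ω)) (x, y) = mass P Y y := by
  classical
  unfold mass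
  rw [← sum_fiberwise_of_maps_to fun ω _ => hS ω]
  exact sum_congr rfl fun x _ => sum_congr (by ext; simp [and_comm]) fun _ _ => rfl

theorem entropy_mono (hP : ∀ ω, 0 ≤ P ω) {X : Ω → α} {Y : Ω → β} (h : Y.FactorsThrough X) :
    entropy P Y ≤ entropy P X := by
  simp only [entropy_eq_neg_sum_mass]
  refine neg_le_neg (sum_le_sum fun ω _ => ?_)
  rcases eq_or_ne (P ω) 0 with h0 | h0
  · simp [h0]
  · exact mul_le_mul_of_nonneg_left (Real.logb_le_logb_of_le one_lt_two (mass_pos hP X h0)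
      (mass_mono hP fun _ e => h e)) (hP ω)

theorem entropy_congr {X : Ω → α} {Y : Ω → β} (hYX : Y.FactorsThrough X)
    (hXY : X.FactorsThrough Y) : entropy P X = entropy P Y := by
  simp only [entropy_eq_neg_sum_mass]
  congr 1
  exact sum_congr rfl fun ω _ => by rw [mass_congr fun _ => ⟨fun e => hYX e, fun e => hXY e⟩]

theorem entropy_const (h1 : ∑ ω, P ω = 1) (c : α) : entropy P (fun _ => c) = 0 := by
  simp [entropy_eq_neg_sum_mass, mass_const, h1]

theorem sum_mul_log_sub_log_eq_sum_mul_klFun {ι : Type*} {S : Finset ι} {a b : ι → ℝ}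
    (hb : ∀ i ∈ S, b i = 0 → a i = 0) (hab : ∑ i ∈ S, a i = ∑ i ∈ S, b i) :
    ∑ i ∈ S, a i * (Real.log (a i) - Real.log (b i)) =
      ∑ i ∈ S, b i * InformationTheory.klFun (a i / b i) := by
  have h : ∀ i ∈ S, b i * InformationTheory.klFun (a i / b i) =
      a i * (Real.log (a i) - Real.log (b i)) + (b i - a i) := fun i hi => by
    rcases eq_or_ne (b i) 0 with hb0 | hb0
    · simp [hb0, hb i hi hb0]
    rcases eq_or_ne (a i) 0 with ha0 | ha0
    · simp [ha0, InformationTheory.klFun_zero]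
    · rw [InformationTheory.klFun_apply, Real.log_div ha0 hb0]
      field_simp
      ring
  rw [sum_congr rfl h, sum_add_distrib, sum_sub_distrib, hab, sub_self, add_zero]

/-- The law of `(X, Y, Z)` that has the same laws of `(X, Z)` and `(Y, Z)` and makes `X` and `Y`
conditionally independent given `Z`; it is `0` where the law of `Z` vanishes, as there
`_ / 0 = 0`. -/
def condIndepMass (P : Ω → ℝ) (X : Ω → α) (Y : Ω → β) (Z : Ω → γ) (t : α × β × γ) : ℝ :=
  mass P (fun ω => (X ω, Z ω)) (t.1, t.2.2) * mass P (fun ω => (Y ω, Z ω)) t.2 / mass P Z t.2.2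

theorem condIndepMass_nonneg (hP : ∀ ω, 0 ≤ P ω) (X : Ω → α) (Y : Ω → β) (Z : Ω → γ)
    (t : α × β × γ) : 0 ≤ condIndepMass P X Y Z t :=
  div_nonneg (mul_nonneg (mass_nonneg hP _ _) (mass_nonneg hP _ _)) (mass_nonneg hP _ _)

theorem mass_pos_of_mass_prodMk_pos (hP : ∀ ω, 0 ≤ P ω) {X : Ω → α} {Y : Ω → β} {x : α} {y : β}
    (h : 0 < mass P (fun ω => (X ω, Y ω)) (x, y)) : 0 < mass P Y y :=
  h.trans_le (mass_mono hP fun _ e => (Prod.ext_iff.1 e).2)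

theorem condIndepMass_pos (hP : ∀ ω, 0 ≤ P ω) {X : Ω → α} {Y : Ω → β} {Z : Ω → γ}
    {t : α × β × γ} (h : 0 < mass P (fun ω => (X ω, Y ω, Z ω)) t) :
    0 < condIndepMass P X Y Z t := by
  have hYZ := mass_pos_of_mass_prodMk_pos hP h
  have hXZ : 0 < mass P (fun ω => (X ω, Z ω)) (t.1, t.2.2) :=
    h.trans_le (mass_mono hP fun _ e => by simp [← e])
  exact div_pos (mul_pos hXZ hYZ) (mass_pos_of_mass_prodMk_pos hP hYZ)

theorem sum_mass_eq_sum_condIndepMass (P : Ω → ℝ) (X : Ω → α) (Y : Ω → β) (Z : Ω → γ)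
    {S : Finset α} {T : Finset β} {U : Finset γ} (hS : ∀ ω, X ω ∈ S) (hT : ∀ ω, Y ω ∈ T) :
    ∑ t ∈ S ×ˢ T ×ˢ U, mass P (fun ω => (X ω, Y ω, Z ω)) t =
      ∑ t ∈ S ×ˢ T ×ˢ U, condIndepMass P X Y Z t := by
  simp only [condIndepMass, sum_product_right]
  refine sum_congr rfl fun z _ => ?_
  simp only [sum_mass_prodMk P X _ hS, sum_mass_prodMk P Y _ hT, ← sum_div, ← sum_mul, ← mul_sum]
  rcases eq_or_ne (mass P Z z) 0 with h0 | h0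
  · simp [h0]
  · field_simp

open Classical in
theorem condMutualInfo_eq_sum_klFun (hP : ∀ ω, 0 ≤ P ω) (X : Ω → α) (Y : Ω → β) (Z : Ω → γ) :
    condMutualInfo P X Y Z = (Real.log 2)⁻¹ * ∑ t ∈ univ.image X ×ˢ univ.image Y ×ˢ univ.image Z,
      condIndepMass P X Y Z t * InformationTheory.klFun
        (mass P (fun ω => (X ω, Y ω, Z ω)) t / condIndepMass P X Y Z t) := by
  have hX : ∀ ω, X ω ∈ univ.image X := fun ω => mem_image_of_mem X (mem_univ ω)
  have hY : ∀ ω, Y ω ∈ univ.image Y := fun ω => mem_image_of_mem Y (mem_univ ω)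
  have hZ : ∀ ω, Z ω ∈ univ.image Z := fun ω => mem_image_of_mem Z (mem_univ ω)
  rw [← sum_mul_log_sub_log_eq_sum_mul_klFun
      (fun t _ h => of_not_not fun h' => (condIndepMass_pos hP
        ((mass_nonneg hP _ _).lt_of_ne' h')).ne' h)
      (sum_mass_eq_sum_condIndepMass P X Y Z hX hY),
    ← sum_mul_comp_eq_sum_mass_mul P (fun ω => (X ω, Y ω, Z ω))
      (fun ω => mem_product.2 ⟨hX ω, mem_product.2 ⟨hY ω, hZ ω⟩⟩) fun t =>
        Real.log (mass P (fun ω => (X ω, Y ω, Z ω)) t) - Real.log (condIndepMass P X Y Z t)]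
  simp only [condMutualInfo, condEntropy, entropy_eq_neg_sum_mass, Real.logb, mul_sum]
  simp only [← sum_neg_distrib, ← sum_sub_distrib]
  refine sum_congr rfl fun ω _ => ?_
  rcases eq_or_ne (P ω) 0 with h0 | h0
  · simp [h0]
  rw [condIndepMass, Real.log_div (mul_ne_zero (mass_pos hP _ h0).ne' (mass_pos hP _ h0).ne')
    (mass_pos hP _ h0).ne', Real.log_mul (mass_pos hP _ h0).ne' (mass_pos hP _ h0).ne']
  ring

theorem condMutualInfo_nonneg (hP : ∀ ω, 0 ≤ P ω) (X : Ω → α) (Y : Ω → β) (Z : Ω → γ) :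
    0 ≤ condMutualInfo P X Y Z := by
  rw [condMutualInfo_eq_sum_klFun hP]
  exact mul_nonneg (inv_nonneg.2 (Real.log_nonneg one_le_two)) (sum_nonneg fun t _ =>
    mul_nonneg (condIndepMass_nonneg hP X Y Z t) (InformationTheory.klFun_nonneg
      (div_nonneg (mass_nonneg hP _ t) (condIndepMass_nonneg hP X Y Z t))))

theorem mass_eq_condIndepMass (hP : ∀ ω, 0 ≤ P ω) {X : Ω → α} {Y : Ω → β} {Z : Ω → γ}
    (h : condMutualInfo P X Y Z = 0) (t : α × β × γ) :
    mass P (fun ω => (X ω, Y ω, Z ω)) t = condIndepMass P X Y Z t := by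
  classical
  have hratio : ∀ t, 0 ≤ mass P (fun ω => (X ω, Y ω, Z ω)) t / condIndepMass P X Y Z t := fun t =>
    div_nonneg (mass_nonneg hP _ t) (condIndepMass_nonneg hP X Y Z t)
  rcases (condIndepMass_nonneg hP X Y Z t).eq_or_lt' with hb | hb
  · rw [hb]
    exact le_antisymm (not_lt.1 fun h' => (condIndepMass_pos hP h').ne' hb) (mass_nonneg hP _ _)
  by_cases ht : t ∈ univ.image X ×ˢ univ.image Y ×ˢ univ.image Z
  · rw [condMutualInfo_eq_sum_klFun hP, mul_eq_zero, inv_eq_zero,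
      or_iff_right (Real.log_pos one_lt_two).ne', sum_eq_zero_iff_of_nonneg fun t _ =>
        mul_nonneg (condIndepMass_nonneg hP X Y Z t) (InformationTheory.klFun_nonneg (hratio t))]
      at h
    exact eq_of_div_eq_one ((InformationTheory.klFun_eq_zero_iff (hratio t)).1
      ((mul_eq_zero.1 (h t ht)).resolve_left hb.ne'))
  · refine absurd ht (not_not.2 ?_)
    have hXZ : mass P (fun ω => (X ω, Z ω)) (t.1, t.2.2) ≠ 0 := fun h0 => by
      simp [condIndepMass, h0] at hb
    have hYZ : mass P (fun ω => (Y ω, Z ω)) t.2 ≠ 0 := fun h0 => by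
      simp [condIndepMass, h0] at hb
    obtain ⟨ω, hω⟩ := not_forall_not.1 (mt mass_eq_zero hXZ)
    obtain ⟨ω', hω'⟩ := not_forall_not.1 (mt mass_eq_zero hYZ)
    simp only [Prod.ext_iff] at hω hω'
    simp only [mem_product, mem_image, mem_univ, true_and]
    exact ⟨⟨ω, hω.1⟩, ⟨ω', hω'.1⟩, ⟨ω', hω'.2⟩⟩

theorem mass_mul_mass_comp_of_condMutualInfo_eq_zero (hP : ∀ ω, 0 ≤ P ω) {X : Ω → α} {Y : Ω → β}
    {g : α → γ} (h : condMutualInfo P X Y (fun ω => g (X ω)) = 0) (x : α) (y : β) :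
    mass P (fun ω => (X ω, Y ω)) (x, y) * mass P (fun ω => g (X ω)) (g x) =
      mass P X x * mass P (fun ω => (Y ω, g (X ω))) (y, g x) := by
  have hXYZ : mass P (fun ω => (X ω, Y ω, g (X ω))) (x, y, g x) =
      mass P (fun ω => (X ω, Y ω)) (x, y) := mass_congr fun ω => by grind
  have hXZ : mass P (fun ω => (X ω, g (X ω))) (x, g x) = mass P X x :=
    mass_congr fun ω => by grind
  have hcond := mass_eq_condIndepMass hP h (x, y, g x)
  rw [condIndepMass, hXYZ, hXZ] at hcond
  rcases (mass_nonneg hP (fun ω => g (X ω)) (g x)).eq_or_lt' with h0 | h0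
  · have hX : mass P X x ≤ mass P (fun ω => g (X ω)) (g x) := mass_mono hP fun _ e => by rw [e]
    rw [h0, mul_zero, le_antisymm (hX.trans h0.le) (mass_nonneg hP X x), zero_mul]
  · rw [hcond, div_mul_cancel₀ _ h0.ne']

theorem entropy_submodular (hP : ∀ ω, 0 ≤ P ω) (X : Ω → α) (Y : Ω → β) (Z : Ω → γ) :
    entropy P (fun ω => (X ω, Y ω, Z ω)) + entropy P Z ≤
      entropy P (fun ω => (X ω, Z ω)) + entropy P (fun ω => (Y ω, Z ω)) := by
  have := condMutualInfo_nonneg hP X Y Z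
  simp only [condMutualInfo, condEntropy] at this
  linarith

theorem condEntropy_mono (hP : ∀ ω, 0 ≤ P ω) {X : Ω → α} {X' : Ω → γ} {Y : Ω → β}
    (h : X.FactorsThrough fun ω => (X' ω, Y ω)) : condEntropy P X Y ≤ condEntropy P X' Y := by
  have hXY : (fun ω => (X ω, Y ω)).FactorsThrough fun ω => (X' ω, Y ω) := fun _ _ e =>
    Prod.ext (h e) (Prod.ext_iff.1 e).2
  exact sub_le_sub_right (entropy_mono hP hXY) _

theorem condEntropy_anti (hP : ∀ ω, 0 ≤ P ω) (X : Ω → α) {Y : Ω → β} {Z : Ω → γ}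
    (h : Y.FactorsThrough Z) : condEntropy P X Z ≤ condEntropy P X Y := by
  have hXZY : entropy P (fun ω => (X ω, Z ω, Y ω)) = entropy P (fun ω => (X ω, Z ω)) :=
    entropy_congr (fun _ _ e => by simp_all only [Prod.mk.injEq]) fun _ _ e => by
      simp only [Prod.mk.injEq] at e ⊢
      exact ⟨e.1, e.2, h e.2⟩
  have hZY : entropy P (fun ω => (Z ω, Y ω)) = entropy P Z :=
    entropy_congr (fun _ _ e => (Prod.ext_iff.1 e).1) fun _ _ e => Prod.ext e (h e)
  have := entropy_submodular hP X Z Y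
  simp only [condEntropy]
  linarith

theorem condEntropy_nonneg (hP : ∀ ω, 0 ≤ P ω) (X : Ω → α) (Y : Ω → β) :
    0 ≤ condEntropy P X Y :=
  sub_nonneg.2 (entropy_mono hP fun _ _ e => (Prod.ext_iff.1 e).2)

theorem condEntropy_const (h1 : ∑ ω, P ω = 1) (X : Ω → α) (c : β) :
    condEntropy P X (fun _ => c) = entropy P X := by
  rw [condEntropy, entropy_const h1, sub_zero]
  exact entropy_congr (fun _ _ e => (Prod.ext_iff.1 e).1) fun _ _ e => Prod.ext e rfl

theorem condEntropy_le_entropy (hP : ∀ ω, 0 ≤ P ω) (h1 : ∑ ω, P ω = 1) (X : Ω → α) (Y : Ω → β) :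
    condEntropy P X Y ≤ entropy P X := by
  rw [← condEntropy_const h1 X ()]
  exact condEntropy_anti hP X fun _ _ _ => rfl

theorem factorsThrough_of_condEntropy_eq_zero (hP : ∀ ω, 0 < P ω) {X : Ω → α} {Y : Ω → β}
    (h : condEntropy P X Y = 0) : X.FactorsThrough Y := by
  have hP0 : ∀ ω, 0 ≤ P ω := fun ω => (hP ω).le
  have hXXY : condEntropy P X (fun ω => (X ω, Y ω)) = 0 :=
    sub_eq_zero.2 (entropy_congr (fun _ _ e => (Prod.ext_iff.1 e).2) fun _ _ e => by grind)
  have hind : condMutualInfo P X X Y = 0 := by rw [condMutualInfo, h, hXXY, sub_zero]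
  intro ω ω' hY
  by_contra hne
  have hzero : mass P (fun ω => (X ω, X ω, Y ω)) (X ω, X ω', Y ω) = 0 :=
    mass_eq_zero fun v e => by grind
  have hω := mass_pos hP0 (fun ω => (X ω, Y ω)) (hP ω).ne'
  have hω' := mass_pos hP0 (fun ω => (X ω, Y ω)) (hP ω').ne'
  rw [mass_eq_condIndepMass hP0 hind, condIndepMass] at hzero
  rw [← hY] at hω'
  exact (div_pos (mul_pos hω hω') (mass_pos hP0 Y (hP ω).ne')).ne' hzero

theorem condMutualInfo_eq_zero_of_factorsThrough (hP : ∀ ω, 0 ≤ P ω) {X : Ω → α} {Y : Ω → β}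
    {Y' : Ω → δ} {Z : Ω → γ} (h : condMutualInfo P X Y Z = 0) (hY : Y'.FactorsThrough Y) :
    condMutualInfo P X Y' Z = 0 := by
  refine le_antisymm ?_ (condMutualInfo_nonneg hP X Y' Z)
  rw [← h]
  have hYZ : (fun ω => (Y' ω, Z ω)).FactorsThrough fun ω => (Y ω, Z ω) := fun _ _ e =>
    Prod.ext (hY (Prod.ext_iff.1 e).1) (Prod.ext_iff.1 e).2
  exact sub_le_sub_left (condEntropy_anti hP X hYZ) _

theorem condMutualInfo_congr_right (hP : ∀ ω, 0 ≤ P ω) (X : Ω → α) (Y : Ω → β) {Z : Ω → γ}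
    {Z' : Ω → δ} (h : Z'.FactorsThrough Z) (h' : Z.FactorsThrough Z') :
    condMutualInfo P X Y Z = condMutualInfo P X Y Z' := by
  have hYZ : (fun ω => (Y ω, Z' ω)).FactorsThrough fun ω => (Y ω, Z ω) := fun _ _ e =>
    Prod.ext (Prod.ext_iff.1 e).1 (h (Prod.ext_iff.1 e).2)
  have hYZ' : (fun ω => (Y ω, Z ω)).FactorsThrough fun ω => (Y ω, Z' ω) := fun _ _ e =>
    Prod.ext (Prod.ext_iff.1 e).1 (h' (Prod.ext_iff.1 e).2)
  exact congrArg₂ (· - ·) (le_antisymm (condEntropy_anti hP X h) (condEntropy_anti hP X h'))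
    (le_antisymm (condEntropy_anti hP X hYZ) (condEntropy_anti hP X hYZ'))

theorem condEntropy_tuple_le (hP : ∀ ω, 0 ≤ P ω) {κ : Type*} {ξ : κ → Type*}
    (X : ∀ k, Ω → ξ k) (Y : Ω → β) (S : Finset κ) :
    condEntropy P (fun ω (k : S) => X k ω) Y ≤ ∑ k ∈ S, condEntropy P (X k) Y := by
  classical
  induction S using Finset.induction_on with
  | empty =>
    exact sub_nonpos.2 (entropy_mono hP fun _ _ e => Prod.ext (Subsingleton.elim _ _) e)
  | insert a S ha ih =>
    have hcons : entropy P (fun ω => ((fun k : (insert a S : Finset κ) => X k ω), Y ω)) ≤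
        entropy P (fun ω => (X a ω, (fun k : S => X k ω), Y ω)) := by
      refine entropy_mono hP fun ω ω' e => ?_
      simp only [Prod.mk.injEq] at e ⊢
      refine ⟨funext fun ⟨k, hk⟩ => ?_, e.2.2⟩
      rcases mem_insert.1 hk with rfl | hk
      · exact e.1
      · exact congrFun e.2.1 ⟨k, hk⟩
    have hsub := entropy_submodular hP (X a) (fun ω (k : S) => X k ω) Y
    rw [sum_insert ha]
    simp only [condEntropy] at ih ⊢
    linarith

theorem entropy_tuple_le (hP : ∀ ω, 0 ≤ P ω) (h1 : ∑ ω, P ω = 1) {κ : Type*} {ξ : κ → Type*}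
    (X : ∀ k, Ω → ξ k) (S : Finset κ) :
    entropy P (fun ω (k : S) => X k ω) ≤ ∑ k ∈ S, entropy P (X k) := by
  simpa only [condEntropy_const h1] using condEntropy_tuple_le hP X (fun _ => ()) S

end Toolkit

/-! ### Mixtures -/

section Mixture

variable {Ω τ L : Type*} [Fintype Ω] [Fintype L] {α β : Type*}
  {P : Ω → ℝ} {μ : τ → ℝ} {ν : L → ℝ}

theorem mass_prodMk_fst (e : Ω ≃ τ × L) (hP : ∀ ω, P ω = μ (e ω).1 * ν (e ω).2) (X : Ω → α)
    (x : α) (t : τ) :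
    mass P (fun ω => (X ω, (e ω).1)) (x, t) = μ t * mass ν (fun l => X (e.symm (t, l))) x := by
  classical
  rw [mass, mass, mul_sum]
  refine sum_bij' (fun ω _ => (e ω).2) (fun l _ => e.symm (t, l)) ?_ ?_ ?_ ?_ ?_ <;>
    simp only [mem_filter_univ, Prod.mk.injEq]
  · rintro ω ⟨rfl, rfl⟩
    simp
  · simp +contextual
  · rintro ω ⟨-, rfl⟩
    simp
  · simp
  · simp +contextual [hP]

theorem mass_fst (e : Ω ≃ τ × L) (hP : ∀ ω, P ω = μ (e ω).1 * ν (e ω).2) (hν1 : ∑ l, ν l = 1)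
    (t : τ) : mass P (fun ω => (e ω).1) t = μ t := by
  rw [mass_congr (Y := fun ω => ((), (e ω).1)) (y := ((), t)) (by simp),
    mass_prodMk_fst e hP fun _ => (), mass_const, hν1, mul_one]

variable [Fintype τ]

theorem mass_comp_fst {g : τ → α} (e : Ω ≃ τ × L) (hP : ∀ ω, P ω = μ (e ω).1 * ν (e ω).2)
    (hν1 : ∑ l, ν l = 1) (x : α) : mass P (fun ω => g (e ω).1) x = mass μ g x := by
  classical
  simp only [mass, sum_filter]
  rw [← e.symm.sum_comp, Fintype.sum_prod_type]
  refine sum_congr rfl fun t _ => ?_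
  simp only [hP, Equiv.apply_symm_apply]
  split_ifs
  · rw [← mul_sum, hν1, mul_one]
  · exact sum_const_zero

theorem entropy_prodMk_fst (e : Ω ≃ τ × L) (hP : ∀ ω, P ω = μ (e ω).1 * ν (e ω).2)
    (hν : ∀ l, 0 ≤ ν l) (hν1 : ∑ l, ν l = 1) (X : Ω → α) :
    entropy P (fun ω => (X ω, (e ω).1)) = entropy P (fun ω => (e ω).1) +
      ∑ t, μ t * entropy ν (fun l => X (e.symm (t, l))) := by
  simp only [entropy_eq_neg_sum_mass, mass_fst e hP hν1, mass_prodMk_fst e hP X]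
  rw [← e.symm.sum_comp, ← e.symm.sum_comp fun ω => P ω * Real.logb 2 (μ (e ω).1)]
  simp only [Fintype.sum_prod_type, hP, Equiv.apply_symm_apply, mul_neg, sum_neg_distrib,
    ← neg_add, ← sum_add_distrib, mul_sum]
  refine congrArg _ (sum_congr rfl fun t _ => sum_congr rfl fun l _ => ?_)
  rcases eq_or_ne (μ t) 0 with h0 | h0
  · simp [h0]
  rcases eq_or_ne (ν l) 0 with h1 | h1
  · simp [h1]
  rw [Real.logb_mul h0 (mass_pos hν (fun l => X (e.symm (t, l))) h1).ne']
  ring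

theorem sum_mul_entropy_le_entropy (e : Ω ≃ τ × L) (hP : ∀ ω, P ω = μ (e ω).1 * ν (e ω).2)
    (hμ : ∀ t, 0 ≤ μ t) (hν : ∀ l, 0 ≤ ν l) (hμ1 : ∑ t, μ t = 1) (hν1 : ∑ l, ν l = 1)
    (X : Ω → α) : ∑ t, μ t * entropy ν (fun l => X (e.symm (t, l))) ≤ entropy P X := by
  have hP0 : ∀ ω, 0 ≤ P ω := fun ω => by rw [hP]; exact mul_nonneg (hμ _) (hν _)
  have hP1 : ∑ ω, P ω = 1 := by
    rw [← e.symm.sum_comp, Fintype.sum_prod_type]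
    simp [hP, ← mul_sum, hν1, hμ1]
  have hcond := condEntropy_le_entropy hP0 hP1 X fun ω => (e ω).1
  rw [condEntropy, entropy_prodMk_fst e hP hν hν1 X] at hcond
  linarith

theorem sum_mul_condEntropy_le_condEntropy (e : Ω ≃ τ × L)
    (hP : ∀ ω, P ω = μ (e ω).1 * ν (e ω).2) (hμ : ∀ t, 0 ≤ μ t) (hν : ∀ l, 0 ≤ ν l)
    (hν1 : ∑ l, ν l = 1) (X : Ω → α) (Y : Ω → β) :
    ∑ t, μ t * condEntropy ν (fun l => X (e.symm (t, l))) (fun l => Y (e.symm (t, l))) ≤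
      condEntropy P X Y := by
  have hP0 : ∀ ω, 0 ≤ P ω := fun ω => by rw [hP]; exact mul_nonneg (hμ _) (hν _)
  have hcond := condEntropy_anti hP0 X (Y := Y) (Z := fun ω => (Y ω, (e ω).1))
    fun _ _ h => congrArg Prod.fst h
  have hassoc : entropy P (fun ω => (X ω, Y ω, (e ω).1)) =
      entropy P (fun ω => ((X ω, Y ω), (e ω).1)) :=
    entropy_congr (fun _ _ e => by grind) fun _ _ e => by grind
  refine le_trans (le_of_eq ?_) hcond
  simp only [condEntropy, mul_sub, sum_sub_distrib, hassoc, entropy_prodMk_fst e hP hν hν1]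
  ring

end Mixture

/-! ### Random orders and affine minorants of `1 / (x + 1)` -/

section RandomOrder

variable {κ : Type*} [Fintype κ] [LinearOrder κ] {J : Finset κ} {j : κ}

theorem sum_card_perm_forall_le (hJ : J.Nonempty) :
    ∑ j ∈ J, #{π : Equiv.Perm κ | ∀ s ∈ J, π j ≤ π s} = (Fintype.card κ).factorial := by
  have hunique : ∀ π : Equiv.Perm κ, #{j ∈ J | ∀ s ∈ J, π j ≤ π s} = 1 := fun π => by
    obtain ⟨j, hj, hmin⟩ := J.exists_min_image π hJ
    refine card_eq_one.2 ⟨j, ext fun i => ⟨fun hi => ?_, fun hi => ?_⟩⟩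
    · obtain ⟨hi, himin⟩ := mem_filter.1 hi
      exact mem_singleton.2 (π.injective (le_antisymm (himin j hj) (hmin i hi)))
    · rw [mem_singleton.1 hi]
      exact mem_filter.2 ⟨hj, hmin⟩
  simp only [card_filter] at hunique ⊢
  rw [sum_comm, sum_congr rfl fun π _ => hunique π, sum_const, card_univ, Fintype.card_perm,
    smul_eq_mul, mul_one]

theorem card_perm_forall_le_eq {i : κ} (hi : i ∈ J) (hj : j ∈ J) :
    #{π : Equiv.Perm κ | ∀ s ∈ J, π i ≤ π s} = #{π : Equiv.Perm κ | ∀ s ∈ J, π j ≤ π s} := by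
  have hswap : ∀ s, Equiv.swap i j s ∈ J ↔ s ∈ J := fun s => by
    rw [Equiv.swap_apply_def]
    split_ifs <;> simp_all
  refine card_equiv (Equiv.mulRight (Equiv.swap i j)) fun π => ?_
  simp only [mem_filter, mem_univ, true_and, Equiv.coe_mulRight, Equiv.Perm.mul_apply,
    Equiv.swap_apply_right]
  exact ⟨fun h s hs => h _ ((hswap s).2 hs), fun h s hs => by
    simpa using h (Equiv.swap i j s) ((hswap s).2 hs)⟩

theorem card_mul_card_perm_forall_le (hj : j ∈ J) :
    #J * #{π : Equiv.Perm κ | ∀ s ∈ J, π j ≤ π s} = (Fintype.card κ).factorial := by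
  rw [← sum_card_perm_forall_le ⟨j, hj⟩, sum_congr rfl fun i hi => card_perm_forall_le_eq hi hj,
    sum_const, smul_eq_mul]

end RandomOrder

/-- The intercept of an affine minorant of `x ↦ 1 / (x + 1)` on the integers `0 ≤ x ≤ t - 1`: it
weights the demanded bits. The minorant is the chord through `h` and `h + 1`, corrected by a term
of order `1 / t`. -/
def bitWeight (h : ℕ) (t : ℝ) : ℝ := (h + 2 * t) / ((h + 2) * t)

/-- The absolute slope of the minorant of `bitWeight`: it weights the overlaps of demanded bits
with the caches that serve the other demands. -/
def overlapWeight (h : ℕ) (t : ℝ) : ℝ := (2 * h + t) / ((h + 1) * (h + 2) * t)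

theorem bitWeight_nonneg (h : ℕ) {t : ℝ} (ht : 0 ≤ t) : 0 ≤ bitWeight h t := by
  unfold bitWeight; positivity

theorem overlapWeight_nonneg (h : ℕ) {t : ℝ} (ht : 0 ≤ t) : 0 ≤ overlapWeight h t := by
  unfold overlapWeight; positivity

theorem mul_sub_one_nonneg_of_int (a : ℤ) : 0 ≤ a * (a - 1) := by
  rcases le_or_gt a 0 with h | h
  · nlinarith
  · exact mul_nonneg h.le (by lia)

theorem bitWeight_sub_overlapWeight_mul_le (h : ℕ) {x : ℕ} {t : ℝ} (hx : x + 1 ≤ t) :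
    bitWeight h t - overlapWeight h t * x ≤ 1 / ((x : ℝ) + 1) := by
  have ht : 0 < t := (by positivity : (0 : ℝ) < x + 1).trans_le hx
  have hx1 : (0 : ℝ) ≤ x * (x - 1) := by exact_mod_cast mul_sub_one_nonneg_of_int x
  have hxh : (0 : ℝ) ≤ (x - h) * (x - h - 1) := by
    exact_mod_cast mul_sub_one_nonneg_of_int (x - h)
  have hdiff : 1 / ((x : ℝ) + 1) - (bitWeight h t - overlapWeight h t * x) =
      ((t - 1 - x) * ((x - h) * (x - h - 1)) + (x + 1) * (x * (x - 1))) /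
        ((h + 1) * (h + 2) * t * (x + 1)) := by
    unfold bitWeight overlapWeight
    field_simp
    ring
  have htx : 0 ≤ t - 1 - x := by linarith
  rw [← sub_nonneg, hdiff]
  positivity

/-! ### Uniform independent bits -/

section Bits

theorem dependsOn_inter {ι α : Type*} {β : ι → Type*} {V : (∀ i, β i) → α} {A B : Set ι}
    (hA : DependsOn V A) (hB : DependsOn V B) : DependsOn V (A ∩ B) := by
  classical
  intro f g hfg
  calc V f = V (A.piecewise f g) := hA fun i hi => by simp [hi]
    _ = V g := hB fun i hi => by
      by_cases hiA : i ∈ A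
      · simpa [hiA] using hfg i ⟨hiA, hi⟩
      · simp [hiA]

theorem dependsOn_iInter {κ ι α : Type*} [Finite κ] {β : ι → Type*} {V : (∀ i, β i) → α}
    {A : κ → Set ι} (hA : ∀ j, DependsOn V (A j)) : DependsOn V (⋂ j, A j) := by
  have hfin : ∀ J : Set κ, J.Finite → DependsOn V (⋂ j ∈ J, A j) := fun J hJ => by
    induction J, hJ using Set.Finite.induction_on with
    | empty => simpa using dependsOn_univ V
    | insert _ _ ih =>
      rw [Set.biInter_insert]
      exact dependsOn_inter (hA _) ih
  simpa using hfin Set.univ Set.finite_univ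

/-- The law of independent fair bits. -/
def fair (ι : Type*) [Fintype ι] : (ι → Bool) → ℝ := fun _ => (1 / 2) ^ Fintype.card ι

variable {ι : Type*} {α β : Type*}

theorem fair_pos [Fintype ι] (f : ι → Bool) : 0 < fair ι f := by unfold fair; positivity

theorem fair_nonneg [Fintype ι] (f : ι → Bool) : 0 ≤ fair ι f := (fair_pos f).le

theorem sum_fair [Fintype ι] [DecidableEq ι] : ∑ f : ι → Bool, fair ι f = 1 := by
  simp [fair]

theorem restrict_eq_restrict_iff {A : Finset ι} {f g : ι → Bool} :
    A.restrict f = A.restrict g ↔ ∀ i ∈ A, f i = g i := by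
  simp [funext_iff]

theorem cast_card_union [DecidableEq ι] (A B : Finset ι) : (#(A ∪ B) : ℝ) = #(A \ B) + #B := by
  exact_mod_cast (card_sdiff_add_card A B).symm

variable [Fintype ι] [DecidableEq ι]

theorem mass_restrict (A : Finset ι) (g : ι → Bool) :
    mass (fair ι) A.restrict (A.restrict g) = (1 / 2) ^ #A := by
  classical
  have hfiber : ({f | A.restrict f = A.restrict g} : Finset (ι → Bool)) =
      Fintype.piFinset fun i => if i ∈ A then {g i} else univ := by
    ext f
    simp only [mem_filter, mem_univ, true_and, Fintype.mem_piFinset, restrict_eq_restrict_iff]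
    refine forall_congr' fun i => ?_
    split_ifs with hi <;> simp [hi]
  have hcard : #{f : ι → Bool | A.restrict f = A.restrict g} = 2 ^ #Aᶜ := by
    rw [hfiber, Fintype.card_piFinset]
    simp [apply_ite, prod_ite, filter_not, ← compl_eq_univ_sdiff]
  have hmass : mass (fair ι) A.restrict (A.restrict g) = 2 ^ #Aᶜ * (1 / 2) ^ Fintype.card ι := by
    simp only [mass, fair, sum_const, nsmul_eq_mul]
    norm_cast
    rw [← hcard]
    congr!
  rw [hmass, ← card_compl_add_card A, pow_add, ← mul_assoc, ← mul_pow]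
  norm_num

theorem entropy_restrict (A : Finset ι) : entropy (fair ι) A.restrict = #A := by
  simp only [entropy_eq_neg_sum_mass, mass_restrict]
  rw [← sum_mul, sum_fair, Real.logb_pow, one_div, Real.logb_inv, Real.logb_self_eq_one one_lt_two]
  ring

theorem entropy_restrict_prodMk (A B : Finset ι) :
    entropy (fair ι) (fun f => (A.restrict f, B.restrict f)) = #(A ∪ B) := by
  rw [← entropy_restrict]
  refine entropy_congr (fun f g h => ?_) fun f g h => ?_ <;>
    simp only [Prod.mk.injEq, restrict_eq_restrict_iff, mem_union] at h ⊢ <;> grind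

/-- The equivocation of the bits in `F`: the uncertainty about them that remains for a receiver
who observes the signal `V` and knows the bits in `C`. -/
def equivocation (V : (ι → Bool) → α) (C F : Finset ι) : ℝ :=
  condEntropy (fair ι) F.restrict (fun f => (V f, C.restrict f))

theorem equivocation_nonneg (V : (ι → Bool) → α) (C F : Finset ι) : 0 ≤ equivocation V C F :=
  condEntropy_nonneg fair_nonneg _ _

theorem equivocation_anti {V : (ι → Bool) → α} {V' : (ι → Bool) → β} {C C' : Finset ι}
    (hV : V.FactorsThrough fun f => (V' f, C'.restrict f)) (hC : C ⊆ C') (F : Finset ι) :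
    equivocation V' C' F ≤ equivocation V C F :=
  condEntropy_anti fair_nonneg _ fun f g h => by
    refine Prod.ext (hV h) ?_
    simp only [Prod.mk.injEq, restrict_eq_restrict_iff] at h ⊢
    exact fun i hi => h.2 i (hC hi)

theorem equivocation_biUnion_le {κ : Type*} (V : (ι → Bool) → α) (C : Finset ι) (F : κ → Finset ι)
    (S : Finset κ) : equivocation V C (S.biUnion F) ≤ ∑ k ∈ S, equivocation V C (F k) := by
  have hparts : (S.biUnion F).restrict.FactorsThrough
      fun (f : ι → Bool) => ((fun k : S => (F k).restrict f), (V f, C.restrict f)) :=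
    fun f g h => by
      refine restrict_eq_restrict_iff.2 fun i hi => ?_
      obtain ⟨k, hk, hik⟩ := mem_biUnion.1 hi
      exact restrict_eq_restrict_iff.1 (congrFun (Prod.ext_iff.1 h).1 ⟨k, hk⟩) i hik
  exact (condEntropy_mono fair_nonneg hparts).trans
    (condEntropy_tuple_le fair_nonneg (fun k => (F k).restrict) _ S)

theorem card_sdiff_le_equivocation {V : (ι → Bool) → α} {S : Set ι} {T C F : Finset ι}
    (hV : DependsOn V S) (hST : S ⊆ T) : (#(F \ (T ∪ C)) : ℝ) ≤ equivocation V C F := by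
  have hfactors : (fun f => (V f, C.restrict f)).FactorsThrough (T ∪ C).restrict :=
    fun f g h => by
      rw [restrict_eq_restrict_iff] at h
      exact Prod.ext (hV fun i hi => h i (mem_union_left _ (hST hi)))
        (restrict_eq_restrict_iff.2 fun i hi => h i (mem_union_right _ hi))
  calc (#(F \ (T ∪ C)) : ℝ) = condEntropy (fair ι) F.restrict (T ∪ C).restrict := by
        rw [condEntropy, entropy_restrict_prodMk, entropy_restrict, cast_card_union]
        ring
    _ ≤ equivocation V C F := condEntropy_anti fair_nonneg _ hfactors

theorem card_sdiff_sub_equivocation_add_condEntropy_le (V : (ι → Bool) → α) (W C F : Finset ι) :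
    (#(F \ (W ∪ C)) : ℝ) - equivocation V C F + condEntropy (fair ι) V (W ∪ C ∪ F).restrict ≤
      condEntropy (fair ι) V W.restrict := by
  have hW : condEntropy (fair ι) V (W ∪ C).restrict ≤ condEntropy (fair ι) V W.restrict :=
    condEntropy_anti fair_nonneg V fun f g h => by
      rw [restrict_eq_restrict_iff] at h ⊢
      exact fun i hi => h i (mem_union_left _ hi)
  have hC : condEntropy (fair ι) F.restrict (fun f => (V f, (W ∪ C).restrict f)) ≤
      equivocation V C F := condEntropy_anti fair_nonneg _ fun f g h => by
    simp only [Prod.mk.injEq, restrict_eq_restrict_iff] at h ⊢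
    exact ⟨h.1, fun i hi => h.2 i (mem_union_right _ hi)⟩
  have hmerge : entropy (fair ι) (fun f => (F.restrict f, V f, (W ∪ C).restrict f)) =
      entropy (fair ι) (fun f => (V f, (W ∪ C ∪ F).restrict f)) := by
    refine entropy_congr (fun f g h => ?_) fun f g h => ?_ <;>
      simp only [Prod.mk.injEq, restrict_eq_restrict_iff, mem_union] at h ⊢ <;> grind
  have hcard := cast_card_union F (W ∪ C)
  rw [union_comm F] at hcard
  simp only [condEntropy, entropy_restrict] at hW hC ⊢
  linarith

section Chain

variable {κ : Type*} [Fintype κ] [LinearOrder κ] (V : (ι → Bool) → α) (C : κ → Finset ι)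

theorem sum_card_first_sub_equivocation_le {F : κ → Finset ι} (hF : Pairwise (Disjoint on F)) :
    ∑ j, ((#{b ∈ F j | ∀ s ≤ j, b ∉ C s} : ℝ) - equivocation V (C j) (F j)) ≤
      entropy (fair ι) V := by
  have hchain : ∀ S : Finset κ,
      ∑ j ∈ S, ((#{b ∈ F j | ∀ s ≤ j, b ∉ C s} : ℝ) - equivocation V (C j) (F j)) +
        condEntropy (fair ι) V (S.biUnion fun s => C s ∪ F s).restrict ≤ entropy (fair ι) V := by
    intro S
    induction S using Finset.induction_on_max with
    | empty => simpa using condEntropy_le_entropy fair_nonneg sum_fair V _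
    | insert j S hj ih =>
      have hnew : {b ∈ F j | ∀ s ≤ j, b ∉ C s} ⊆
          F j \ ((S.biUnion fun s => C s ∪ F s) ∪ C j) := fun b hb => by
        obtain ⟨hbF, hbC⟩ := mem_filter.1 hb
        simp only [mem_sdiff, mem_union, mem_biUnion, not_or, not_exists, not_and]
        exact ⟨hbF, fun s hs => ⟨hbC s (hj s hs).le,
          fun hbs => disjoint_left.1 (hF (hj s hs).ne) hbs hbF⟩, hbC j le_rfl⟩
      have hcard : (#{b ∈ F j | ∀ s ≤ j, b ∉ C s} : ℝ) ≤
          #(F j \ ((S.biUnion fun s => C s ∪ F s) ∪ C j)) := by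
        exact_mod_cast card_le_card hnew
      have hstep := card_sdiff_sub_equivocation_add_condEntropy_le V
        (S.biUnion fun s => C s ∪ F s) (C j) (F j)
      rw [sum_insert fun h => (hj j h).false, biUnion_insert, union_comm (C j ∪ F j),
        ← union_assoc]
      linarith
  have hrest := condEntropy_nonneg fair_nonneg V (univ.biUnion fun s => C s ∪ F s).restrict
  linarith [hchain univ]

theorem sum_card_perm_first_sub_equivocation_le {F : κ → Finset ι}
    (hF : Pairwise (Disjoint on F)) (π : Equiv.Perm κ) :
    ∑ j, ((#{b ∈ F j | ∀ s, π s ≤ π j → b ∉ C s} : ℝ) - equivocation V (C j) (F j)) ≤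
      entropy (fair ι) V := by
  have h := sum_card_first_sub_equivocation_le V (C ∘ π.symm) (F := F ∘ π.symm)
    (hF.comp_of_injective π.symm.injective)
  have hreindex : ∀ j b, (∀ s ≤ π j, b ∉ C (π.symm s)) ↔ ∀ s, π s ≤ π j → b ∉ C s :=
    fun j b => π.symm.forall_congr_left.trans (by simp only [Equiv.symm_symm,
      Equiv.symm_apply_apply])
  rw [← Equiv.sum_comp π] at h
  simpa only [Function.comp_apply, Equiv.symm_apply_apply, hreindex] using h

end Chain

end Bits

section Weights

variable {ι κ : Type*} [DecidableEq ι] [Fintype κ] [LinearOrder κ] {C : κ → Finset ι}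

theorem card_succ_mul_card_perm_first {j : κ} {b : ι} (hb : b ∉ C j) :
    (#{s | b ∈ C s} + 1) * #{π : Equiv.Perm κ | ∀ s, π s ≤ π j → b ∉ C s} =
      (Fintype.card κ).factorial := by
  rw [← card_mul_card_perm_forall_le (J := insert j ({s | b ∈ C s} : Finset κ))
      (mem_insert_self _ _),
    card_insert_of_notMem (by simpa using hb)]
  congr 2
  ext π
  simp only [mem_filter, mem_univ, true_and, mem_insert, forall_eq_or_imp, le_refl]
  refine forall_congr' fun s => ⟨fun h hs => ?_, fun h hle hs => ?_⟩
  · exact le_of_not_ge fun hle => h hle hs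
  · exact hb (π.injective (le_antisymm hle (h hs)) ▸ hs)

theorem factorial_mul_weights_le_card_perm_first (h : ℕ) {j : κ} {b : ι} (hb : b ∉ C j) :
    (Fintype.card κ).factorial * (bitWeight h (Fintype.card κ) -
        overlapWeight h (Fintype.card κ) * #{s | b ∈ C s}) ≤
      (#{π : Equiv.Perm κ | ∀ s, π s ≤ π j → b ∉ C s} : ℝ) := by
  have hweights := bitWeight_sub_overlapWeight_mul_le h (x := #{s | b ∈ C s})
    (t := Fintype.card κ) (by exact_mod_cast card_lt_univ_of_notMem (x := j) (by simpa using hb))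
  refine (mul_le_mul_of_nonneg_left hweights (Nat.cast_nonneg _)).trans_eq ?_
  rw [← card_succ_mul_card_perm_first hb]
  push_cast
  field_simp

theorem factorial_mul_card_sdiff_le_sum_perm (h : ℕ) (C : κ → Finset ι) (F : Finset ι) (j : κ) :
    (Fintype.card κ).factorial * (bitWeight h (Fintype.card κ) * #(F \ C j) -
        overlapWeight h (Fintype.card κ) * ∑ i, (#((F \ C j) ∩ C i) : ℝ)) ≤
      ∑ π : Equiv.Perm κ, (#{b ∈ F | ∀ s, π s ≤ π j → b ∉ C s} : ℝ) := by
  have hperm : ∑ π : Equiv.Perm κ, (#{b ∈ F | ∀ s, π s ≤ π j → b ∉ C s} : ℝ) =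
      ∑ b ∈ F, (#{π : Equiv.Perm κ | ∀ s, π s ≤ π j → b ∉ C s} : ℝ) := by
    simp only [card_filter, Nat.cast_sum]
    exact sum_comm
  have hoverlap : ∑ i, (#((F \ C j) ∩ C i) : ℝ) = ∑ b ∈ F \ C j, (#{s | b ∈ C s} : ℝ) := by
    simp only [← filter_mem_eq_inter, card_filter, Nat.cast_sum]
    exact sum_comm
  rw [hperm, hoverlap]
  calc _ = ∑ b ∈ F \ C j, (Fintype.card κ).factorial * (bitWeight h (Fintype.card κ) -
          overlapWeight h (Fintype.card κ) * (#{s | b ∈ C s} : ℝ)) := by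
        rw [← mul_sum, sum_sub_distrib, mul_sum, sum_const, nsmul_eq_mul,
          mul_comm (#(F \ C j) : ℝ)]
    _ ≤ ∑ b ∈ F \ C j, (#{π : Equiv.Perm κ | ∀ s, π s ≤ π j → b ∉ C s} : ℝ) :=
        sum_le_sum fun b hb => factorial_mul_weights_le_card_perm_first h (mem_sdiff.1 hb).2
    _ ≤ _ := sum_le_sum_of_subset_of_nonneg sdiff_subset fun _ _ _ => Nat.cast_nonneg _

end Weights

section Chain

variable {ι κ : Type*} [Fintype ι] [DecidableEq ι] [Fintype κ] [LinearOrder κ] {α : Type*}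

theorem sum_weighted_card_sub_equivocation_le (h : ℕ) (V : (ι → Bool) → α) (C : κ → Finset ι)
    {F : κ → Finset ι} (hF : Pairwise (Disjoint on F)) :
    ∑ j, (bitWeight h (Fintype.card κ) * #(F j \ C j) -
        overlapWeight h (Fintype.card κ) * ∑ i, (#((F j \ C j) ∩ C i) : ℝ) -
        equivocation V (C j) (F j)) ≤ entropy (fair ι) V := by
  have hfac : (0 : ℝ) < (Fintype.card κ).factorial := by
    exact_mod_cast (Fintype.card κ).factorial_pos
  refine le_of_mul_le_mul_left ?_ hfac
  calc _ ≤ ∑ j, ∑ π : Equiv.Perm κ, ((#{b ∈ F j | ∀ s, π s ≤ π j → b ∉ C s} : ℝ) -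
          equivocation V (C j) (F j)) := by
        rw [mul_sum]
        refine sum_le_sum fun j _ => ?_
        rw [mul_sub, sum_sub_distrib, sum_const, card_univ, Fintype.card_perm, nsmul_eq_mul]
        exact sub_le_sub_right (factorial_mul_card_sdiff_le_sum_perm h C (F j) j) _
    _ = ∑ π : Equiv.Perm κ, ∑ j, ((#{b ∈ F j | ∀ s, π s ≤ π j → b ∉ C s} : ℝ) -
          equivocation V (C j) (F j)) := sum_comm
    _ ≤ ∑ _π : Equiv.Perm κ, entropy (fair ι) V :=
        sum_le_sum fun π _ => sum_card_perm_first_sub_equivocation_le V C hF π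
    _ = _ := by rw [sum_const, card_univ, Fintype.card_perm, nsmul_eq_mul]

end Chain

/-! ### Two transmitters -/

section TwoTransmitters

section Card

variable {ι : Type*} [DecidableEq ι]

theorem card_le_card_inter_add_card_sdiff_add_card_sdiff (A C F : Finset ι) :
    #F ≤ #(F ∩ (A ∩ C)) + (#(F \ C) + #(F \ A)) := by
  rw [← card_inter_add_card_sdiff F (A ∩ C), inter_comm A, sdiff_inter_distrib_right]
  exact Nat.add_le_add_left (card_union_le _ _) _

-- A bit counted on the left for `C'` misses `S₂`, so either it lies in `A' ∩ C' \ S₂` or it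
-- misses `S₁`; a bit counted for `A'` either lies in `A' ∩ C' ∩ S₂` or misses `S₂`.
theorem card_sdiff_inter_add_card_sdiff_inter_le {A C A' C' F S₁ S₂ : Finset ι} (hSA' : S₁ ⊆ A')
    (hSC : S₂ ⊆ C) (hSC' : S₂ ⊆ C') :
    #((F \ C) ∩ C') + #((F \ A) ∩ A') ≤
      #(F ∩ (A' ∩ C')) + (#(F \ (S₁ ∪ C)) + #(F \ (S₂ ∪ A))) := by
  have hC' : (F \ C) ∩ C' ⊆ ((F ∩ (A' ∩ C')) \ S₂) ∪ F \ (S₁ ∪ C) := by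
    intro b hb
    have := @hSA' b
    have := @hSC b
    simp only [mem_inter, mem_sdiff, mem_union] at hb ⊢
    tauto
  have hA' : (F \ A) ∩ A' ⊆ ((F ∩ (A' ∩ C')) ∩ S₂) ∪ F \ (S₂ ∪ A) := by
    intro b hb
    have := @hSC' b
    simp only [mem_inter, mem_sdiff, mem_union] at hb ⊢
    tauto
  have hsplit := card_sdiff_add_card_inter (F ∩ (A' ∩ C')) S₂
  have hC'card := (card_le_card hC').trans (card_union_le _ _)
  have hA'card := (card_le_card hA').trans (card_union_le _ _)
  lia

end Card

variable {ι κ : Type*} [DecidableEq ι] [Fintype κ] [LinearOrder κ]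

/-- The number of transmitted bits that the two-transmitter converse guarantees for the block `i`
when `Q` is the set of bits cached by both transmitters at the time they serve this block. -/
def blockGain (h : ℕ) (F : κ → Finset ι) (i : κ) (Q : Finset ι) : ℝ :=
  bitWeight h (Fintype.card κ) * (#(F i) - #(F i ∩ Q)) -
    overlapWeight h (Fintype.card κ) * ∑ j ∈ univ.erase i, (#(F j ∩ Q) : ℝ)

variable [Fintype ι] {α β : Type*} {V₁ : (ι → Bool) → α} {V₂ : (ι → Bool) → β}
  {A C : κ → Finset ι}

theorem sum_card_sdiff_inter_le (hA : ∀ i, DependsOn V₁ (A i)) (hC : ∀ i, DependsOn V₂ (C i))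
    (F : Finset ι) (j : κ) :
    ∑ i, (#((F \ C j) ∩ C i) : ℝ) + ∑ i, (#((F \ A j) ∩ A i) : ℝ) ≤
      ∑ i ∈ univ.erase j, (#(F ∩ (A i ∩ C i)) : ℝ) +
        Fintype.card κ * (equivocation V₁ (C j) F + equivocation V₂ (A j) F) := by
  set S₁ : Finset ι := {b | ∀ i, b ∈ A i}
  set S₂ : Finset ι := {b | ∀ i, b ∈ C i}
  set δ := equivocation V₁ (C j) F + equivocation V₂ (A j) F
  have hmissing : (#(F \ (S₁ ∪ C j)) : ℝ) + #(F \ (S₂ ∪ A j)) ≤ δ :=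
    add_le_add
      (card_sdiff_le_equivocation (dependsOn_iInter hA) fun b hb => by simpa [S₁] using hb)
      (card_sdiff_le_equivocation (dependsOn_iInter hC) fun b hb => by simpa [S₂] using hb)
  have hcross : ∀ i, (#((F \ C j) ∩ C i) : ℝ) + #((F \ A j) ∩ A i) ≤
      #(F ∩ (A i ∩ C i)) + δ := fun i => by
    refine le_trans ?_ (add_le_add_right hmissing _)
    have hS₁ : S₁ ⊆ A i := fun b hb => (mem_filter.1 hb).2 i
    have hS₂ : ∀ i, S₂ ⊆ C i := fun i b hb => (mem_filter.1 hb).2 i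
    exact_mod_cast card_sdiff_inter_add_card_sdiff_inter_le hS₁ (hS₂ j) (hS₂ i)
  have hδ : 0 ≤ δ := hmissing.trans' (by positivity)
  calc _ = ∑ i ∈ univ.erase j, ((#((F \ C j) ∩ C i) : ℝ) + #((F \ A j) ∩ A i)) := by
        rw [← sum_add_distrib, ← add_sum_erase univ _ (mem_univ j), sdiff_inter_self,
          sdiff_inter_self, card_empty, Nat.cast_zero, add_zero, zero_add]
    _ ≤ ∑ i ∈ univ.erase j, (#(F ∩ (A i ∩ C i)) : ℝ) + #(univ.erase j) * δ := by
        rw [← nsmul_eq_mul, ← sum_const, ← sum_add_distrib]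
        exact sum_le_sum fun i _ => hcross i
    _ ≤ _ := by
        gcongr
        exact card_le_univ _

theorem sum_blockGain_sub_equivocation_le (h : ℕ) {F : κ → Finset ι}
    (hF : Pairwise (Disjoint on F)) (hA : ∀ i, DependsOn V₁ (A i))
    (hC : ∀ i, DependsOn V₂ (C i)) :
    ∑ i, (blockGain h F i (A i ∩ C i) - (1 + overlapWeight h (Fintype.card κ) * Fintype.card κ) *
        (equivocation V₁ (C i) (F i) + equivocation V₂ (A i) (F i))) ≤
      entropy (fair ι) V₁ + entropy (fair ι) V₂ := by
  have hV₁ := sum_weighted_card_sub_equivocation_le h V₁ C hF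
  have hV₂ := sum_weighted_card_sub_equivocation_le h V₂ A hF
  refine le_trans ?_ (add_le_add hV₁ hV₂)
  set w₀ := bitWeight h (Fintype.card κ)
  set w₁ := overlapWeight h (Fintype.card κ)
  have hw₀ : 0 ≤ w₀ := bitWeight_nonneg h (Nat.cast_nonneg _)
  have hw₁ : 0 ≤ w₁ := overlapWeight_nonneg h (Nat.cast_nonneg _)
  have hswap : ∑ i, blockGain h F i (A i ∩ C i) =
      ∑ j, (w₀ * (#(F j) - #(F j ∩ (A j ∩ C j))) -
        w₁ * ∑ i ∈ univ.erase j, (#(F j ∩ (A i ∩ C i)) : ℝ)) := by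
    simp only [blockGain, sum_sub_distrib, ← mul_sum]
    rw [sum_comm' (s' := fun j => univ.erase j) (t' := univ) fun i j => by simp [eq_comm]]
  rw [sum_sub_distrib, hswap, ← sum_sub_distrib, ← sum_add_distrib]
  refine sum_le_sum fun j _ => ?_
  have hown : (#(F j) : ℝ) - #(F j ∩ (A j ∩ C j)) ≤ #(F j \ C j) + #(F j \ A j) := by
    rw [sub_le_iff_le_add']
    exact_mod_cast card_le_card_inter_add_card_sdiff_add_card_sdiff (A j) (C j) (F j)
  have hown' := mul_le_mul_of_nonneg_left hown hw₀
  have hcross' := mul_le_mul_of_nonneg_left (sum_card_sdiff_inter_le hA hC (F j) j) hw₁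
  linarith

end TwoTransmitters

/-! ### Averaging -/

section Averaging

theorem sum_toReal_pmf {α : Type*} [Fintype α] (p : PMF α) : ∑ a, (p a).toReal = 1 := by
  rw [← ENNReal.toReal_sum fun a _ => p.apply_ne_top a, ← tsum_fintype (L := .unconditional _),
    p.tsum_coe, ENNReal.toReal_one]

theorem exists_sum_mul_le_mul {Z : Type*} [Fintype Z] {w : Z → ℝ} (hw : ∀ z, 0 ≤ w z)
    (hpos : 0 < ∑ z, w z) (f : Z → ℝ) : ∃ z, w z ≠ 0 ∧ ∑ z, w z * f z ≤ (∑ z, w z) * f z := by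
  obtain ⟨z₀, -, hz₀⟩ := exists_ne_zero_of_sum_ne_zero hpos.ne'
  obtain ⟨z, hz, hmax⟩ := exists_max_image ({z | w z ≠ 0} : Finset Z) f ⟨z₀, by simpa using hz₀⟩
  refine ⟨z, (mem_filter.1 hz).2, ?_⟩
  rw [sum_mul]
  refine sum_le_sum fun z' _ => ?_
  rcases eq_or_ne (w z') 0 with hz' | hz'
  · simp [hz']
  · exact mul_le_mul_of_nonneg_left (hmax z' (by simpa using hz')) (hw z')

theorem sum_sum_mul_le_mul_of_forall_support {J Z : Type*} [Fintype J] [Fintype Z]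
    {w f : J → Z → ℝ} {r H : ℝ} (hw : ∀ j z, 0 ≤ w j z) (hr : 0 ≤ r)
    (hsum : ∀ j, ∑ z, w j z = r)
    (h : ∀ z : J → Z, (∀ j, w j (z j) ≠ 0) → ∑ j, f j (z j) ≤ H) :
    ∑ j, ∑ z, w j z * f j z ≤ r * H := by
  rcases hr.eq_or_lt with rfl | hpos
  · have hzero : ∀ j z, w j z = 0 := fun j z =>
      (sum_eq_zero_iff_of_nonneg fun z _ => hw j z).1 (hsum j) z (mem_univ z)
    simp [hzero]
  · choose z hz hle using fun j =>
      exists_sum_mul_le_mul (hw j) (hpos.trans_eq (hsum j).symm) (f j)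
    calc ∑ j, ∑ z, w j z * f j z ≤ ∑ j, r * f j (z j) :=
          sum_le_sum fun j _ => (hle j).trans_eq (by rw [hsum])
      _ = r * ∑ j, f j (z j) := (mul_sum _ _ _).symm
      _ ≤ r * H := mul_le_mul_of_nonneg_left (h z hz) hr

end Averaging

/-! ### Schemes for fixed metadata -/

/-- The position of a bit in the library: the file and the place within the file. -/
abbrev BitIndex (N B : ℕ) : Type := Fin N × Fin B

/-- The bits of file `n`. -/
def fileBits {N : ℕ} (B : ℕ) (n : Fin N) : Finset (BitIndex N B) := {n} ×ˢ univ

namespace Scheme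

variable {K N B : ℕ} (s : Scheme K N B) {PD : PMF (Demand K N)}

section Law

/-- The part of an outcome that does not involve the library. -/
abbrev Metadata : Type := Demand K N × (∀ k, s.CacheMeta k) × (∀ k, s.PacketMeta k)

/-- An outcome, split into the metadata and the bits of the library. -/
def outcomeEquiv : s.Outcome ≃ s.Metadata × (BitIndex N B → Bool) where
  toFun ω := ((ω.1, ω.2.2.1, ω.2.2.2), Function.uncurry ω.2.1)
  invFun t := (t.1.1, Function.curry t.2, t.1.2.1, t.1.2.2)
  left_inv _ := rfl
  right_inv _ := rfl

/-- The joint law of the cache and packet metadata when the demand vector is `d`. -/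
def metaLaw (d : Demand K N) (z : ∀ k, s.CacheMeta k) (p : ∀ k, s.PacketMeta k) : ℝ :=
  (s.placement z).toReal * (s.delivery d z p).toReal

/-- The law of the packet metadata when the demand vector is `d`. -/
def packetLaw (d : Demand K N) (p : ∀ k, s.PacketMeta k) : ℝ := ∑ z, s.metaLaw d z p

/-- The joint law of the demand vector and the cache and packet metadata. -/
def fullLaw (PD : PMF (Demand K N)) (t : s.Metadata) : ℝ :=
  (PD t.1).toReal * s.metaLaw t.1 t.2.1 t.2.2

/-- The expectation of a function of the cache metadata. -/
def cacheExp (φ : (∀ k, s.CacheMeta k) → ℝ) : ℝ := ∑ z, (s.placement z).toReal * φ z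

/-- The expectation of a function of all metadata when the demand vector is `d`. -/
def metaExp (d : Demand K N) (φ : (∀ k, s.CacheMeta k) → (∀ k, s.PacketMeta k) → ℝ) : ℝ :=
  ∑ z, ∑ p, s.metaLaw d z p * φ z p

theorem metaLaw_nonneg (d : Demand K N) (z : ∀ k, s.CacheMeta k) (p : ∀ k, s.PacketMeta k) :
    0 ≤ s.metaLaw d z p := mul_nonneg ENNReal.toReal_nonneg ENNReal.toReal_nonneg

theorem packetLaw_nonneg (d : Demand K N) (p : ∀ k, s.PacketMeta k) : 0 ≤ s.packetLaw d p :=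
  sum_nonneg fun z _ => s.metaLaw_nonneg d z p

theorem sum_metaLaw (d : Demand K N) (z : ∀ k, s.CacheMeta k) :
    ∑ p, s.metaLaw d z p = (s.placement z).toReal := by
  simp only [metaLaw, ← mul_sum, sum_toReal_pmf, mul_one]

theorem fullLaw_nonneg (t : s.Metadata) : 0 ≤ s.fullLaw PD t :=
  mul_nonneg ENNReal.toReal_nonneg (s.metaLaw_nonneg _ _ _)

theorem cacheExp_mono {φ ψ : (∀ k, s.CacheMeta k) → ℝ} (h : ∀ z, φ z ≤ ψ z) :
    s.cacheExp φ ≤ s.cacheExp ψ :=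
  sum_le_sum fun z _ => mul_le_mul_of_nonneg_left (h z) ENNReal.toReal_nonneg

theorem cacheExp_add (φ ψ : (∀ k, s.CacheMeta k) → ℝ) :
    s.cacheExp (fun z => φ z + ψ z) = s.cacheExp φ + s.cacheExp ψ := by
  simp only [cacheExp, mul_add, sum_add_distrib]

theorem cacheExp_const (c : ℝ) : s.cacheExp (fun _ => c) = c := by
  simp only [cacheExp, ← sum_mul, sum_toReal_pmf, one_mul]

theorem cacheExp_const_mul (c : ℝ) (φ : (∀ k, s.CacheMeta k) → ℝ) :
    s.cacheExp (fun z => c * φ z) = c * s.cacheExp φ := by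
  simp only [cacheExp, mul_sum, mul_left_comm]

theorem cacheExp_sum {κ : Type*} (S : Finset κ) (φ : κ → (∀ k, s.CacheMeta k) → ℝ) :
    s.cacheExp (fun z => ∑ i ∈ S, φ i z) = ∑ i ∈ S, s.cacheExp (φ i) := by
  simp only [cacheExp, mul_sum]
  exact sum_comm

theorem metaExp_cache (d : Demand K N) (φ : (∀ k, s.CacheMeta k) → ℝ) :
    s.metaExp d (fun z _ => φ z) = s.cacheExp φ := by
  simp only [metaExp, ← sum_mul, sum_metaLaw, cacheExp]

theorem metaExp_packet (d : Demand K N) (φ : (∀ k, s.PacketMeta k) → ℝ) :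
    s.metaExp d (fun _ p => φ p) = ∑ p, s.packetLaw d p * φ p := by
  rw [metaExp, sum_comm]
  simp only [← sum_mul, packetLaw]

theorem metaExp_sum {κ : Type*} (S : Finset κ) (d : Demand K N)
    (φ : κ → (∀ k, s.CacheMeta k) → (∀ k, s.PacketMeta k) → ℝ) :
    s.metaExp d (fun z p => ∑ i ∈ S, φ i z p) = ∑ i ∈ S, s.metaExp d (φ i) := by
  simp only [metaExp, mul_sum]
  rw [sum_comm (s := S)]
  exact sum_congr rfl fun z _ => sum_comm

theorem metaExp_sub_const_mul (d : Demand K N) (φ : (∀ k, s.CacheMeta k) → ℝ) (c : ℝ)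
    (ψ : (∀ k, s.CacheMeta k) → (∀ k, s.PacketMeta k) → ℝ) :
    s.metaExp d (fun z p => φ z - c * ψ z p) = s.cacheExp φ - c * s.metaExp d ψ := by
  rw [← s.metaExp_cache d]
  simp only [metaExp, mul_sub, sum_sub_distrib, mul_sum, mul_left_comm]

theorem metaExp_mono_of_support {d : Demand K N}
    {φ ψ : (∀ k, s.CacheMeta k) → (∀ k, s.PacketMeta k) → ℝ}
    (h : ∀ z p, s.metaLaw d z p ≠ 0 → φ z p ≤ ψ z p) : s.metaExp d φ ≤ s.metaExp d ψ := by
  refine sum_le_sum fun z _ => sum_le_sum fun p _ => ?_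
  rcases eq_or_ne (s.metaLaw d z p) 0 with h0 | h0
  · simp [h0]
  · exact mul_le_mul_of_nonneg_left (h z p h0) (s.metaLaw_nonneg d z p)

theorem metaExp_nonneg {d : Demand K N} {φ : (∀ k, s.CacheMeta k) → (∀ k, s.PacketMeta k) → ℝ}
    (h : ∀ z p, 0 ≤ φ z p) : 0 ≤ s.metaExp d φ :=
  sum_nonneg fun z _ => sum_nonneg fun p _ => mul_nonneg (s.metaLaw_nonneg d z p) (h z p)

theorem sum_fullLaw_mul (φ : Demand K N → (∀ k, s.CacheMeta k) → (∀ k, s.PacketMeta k) → ℝ) :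
    ∑ t, s.fullLaw PD t * φ t.1 t.2.1 t.2.2 = ∑ d, (PD d).toReal * s.metaExp d (φ d) := by
  simp only [Fintype.sum_prod_type, fullLaw, metaExp, mul_assoc, mul_sum]

theorem sum_fullLaw_mul_eq_of_forall {c : ℝ}
    {φ : Demand K N → (∀ k, s.CacheMeta k) → (∀ k, s.PacketMeta k) → ℝ}
    (h : ∀ d, s.metaExp d (φ d) = c) :
    ∑ t, s.fullLaw PD t * φ t.1 t.2.1 t.2.2 = c := by
  rw [sum_fullLaw_mul]
  simp only [h, ← sum_mul, sum_toReal_pmf, one_mul]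

theorem sum_fullLaw : ∑ t, s.fullLaw PD t = 1 := by
  have h := s.sum_fullLaw_mul_eq_of_forall (PD := PD) (φ := fun _ _ _ => 1) fun d =>
    (s.metaExp_cache d _).trans (s.cacheExp_const 1)
  simpa only [mul_one] using h

theorem prob_eq (ω : s.Outcome) : s.prob PD ω =
    s.fullLaw PD (s.outcomeEquiv ω).1 * fair (BitIndex N B) (s.outcomeEquiv ω).2 := by
  have he : s.outcomeEquiv ω = ((ω.1, ω.2.2.1, ω.2.2.2), Function.uncurry ω.2.1) := rfl
  simp only [he, prob, fullLaw, metaLaw, fair, Fintype.card_prod, Fintype.card_fin]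
  ring

theorem prob_nonneg (ω : s.Outcome) : 0 ≤ s.prob PD ω := by
  rw [prob_eq]
  exact mul_nonneg (s.fullLaw_nonneg _) (fair_nonneg _)

variable {α β : Type*}

theorem sum_fullLaw_mul_entropy_le (PD : PMF (Demand K N)) (X : s.Outcome → α) :
    ∑ t, s.fullLaw PD t * entropy (fair (BitIndex N B)) (fun f => X (s.outcomeEquiv.symm (t, f))) ≤
      entropy (s.prob PD) X :=
  sum_mul_entropy_le_entropy s.outcomeEquiv s.prob_eq s.fullLaw_nonneg fair_nonneg s.sum_fullLaw
    sum_fair X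

theorem sum_fullLaw_mul_condEntropy_le (PD : PMF (Demand K N)) (X : s.Outcome → α)
    (Y : s.Outcome → β) :
    ∑ t, s.fullLaw PD t * condEntropy (fair (BitIndex N B))
      (fun f => X (s.outcomeEquiv.symm (t, f))) (fun f => Y (s.outcomeEquiv.symm (t, f))) ≤
      condEntropy (s.prob PD) X Y :=
  sum_mul_condEntropy_le_condEntropy s.outcomeEquiv s.prob_eq s.fullLaw_nonneg fair_nonneg
    sum_fair X Y

end Law

/-! ### The constraints for fixed metadata -/

section Constraints

/-- The payload of user `k` as a function of the bits of the library. -/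
def payloadBits (k : Fin K) (p : ∀ k, s.PacketMeta k) (f : BitIndex N B → Bool) : List Bool :=
  s.payload k (p k) (Function.curry f)

variable {s}

/-- The positions of the bits that user `k` copies when its metadata are `c`. -/
def IsUncoded.cacheBits (hs : s.IsUncoded) (k : Fin K) (c : s.CacheMeta k) :
    Finset (BitIndex N B) := (hs k c).choose.toFinset

/-- The total uncertainty that the users have about the files they demand, for given metadata. -/
def totalError (hs : s.IsUncoded) (d : Demand K N) (z : ∀ k, s.CacheMeta k)
    (p : ∀ k, s.PacketMeta k) : ℝ :=
  ∑ k, equivocation (fun f j => s.payloadBits j p f) (hs.cacheBits k (z k)) (fileBits B (d k))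

/-- The expectation of `totalError` when the demand vector is `d`. -/
def meanError (hs : s.IsUncoded) (d : Demand K N) : ℝ := s.metaExp d (totalError hs d)

theorem content_curry_eq_iff (hs : s.IsUncoded) {k : Fin K} {c : s.CacheMeta k}
    {f g : BitIndex N B → Bool} :
    s.content k c (Function.curry f) = s.content k c (Function.curry g) ↔
      (hs.cacheBits k c).restrict f = (hs.cacheBits k c).restrict g := by
  have hpos := (hs k c).choose_spec
  rw [hpos, hpos, restrict_eq_restrict_iff, List.map_inj_left]
  simp [IsUncoded.cacheBits, Function.curry]

theorem CacheSize.cacheExp_card_le (hs : s.IsUncoded) {M ε : ℝ} (h : s.CacheSize PD M ε)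
    (k : Fin K) : s.cacheExp (fun z => #(hs.cacheBits k (z k))) ≤ B * (M + ε) := by
  have hH : ∀ t : s.Metadata, entropy (fair (BitIndex N B))
      (fun f => s.Z k (s.outcomeEquiv.symm (t, f))) = #(hs.cacheBits k (t.2.1 k)) := fun t => by
    rw [← entropy_restrict]
    refine entropy_congr (fun f g hfg => (content_curry_eq_iff hs).1 (Prod.ext_iff.1 hfg).2)
      fun f g hfg => Prod.ext rfl ((content_curry_eq_iff hs).2 hfg)
  have hmix := s.sum_fullLaw_mul_entropy_le PD (s.Z k)
  simp only [hH] at hmix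
  rw [s.sum_fullLaw_mul_eq_of_forall (φ := fun _ z _ => (#(hs.cacheBits k (z k)) : ℝ)) fun d =>
    s.metaExp_cache d _] at hmix
  exact hmix.trans (h k)

theorem Load.sum_packetLaw_mul_entropy_le {R ε : ℝ} (h : s.Load PD R ε) {d₀ : Demand K N}
    (hlaw : ∀ d, s.packetLaw d = s.packetLaw d₀) :
    ∑ p, s.packetLaw d₀ p * ∑ k, entropy (fair (BitIndex N B)) (s.payloadBits k p) ≤
      B * (R + ε) := by
  have hH : ∀ k, ∀ t : s.Metadata, entropy (fair (BitIndex N B))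
      (fun f => s.X k (s.outcomeEquiv.symm (t, f))) =
        entropy (fair (BitIndex N B)) (s.payloadBits k t.2.2) := fun k t =>
    entropy_congr (fun f g hfg => (Prod.ext_iff.1 hfg).2) fun f g hfg => Prod.ext rfl hfg
  have hmix := sum_le_sum fun k (_ : k ∈ univ) => s.sum_fullLaw_mul_entropy_le PD (s.X k)
  simp only [hH] at hmix
  rw [sum_comm] at hmix
  simp only [← mul_sum] at hmix
  rw [s.sum_fullLaw_mul_eq_of_forall
    (φ := fun _ _ p => ∑ k, entropy (fair (BitIndex N B)) (s.payloadBits k p)) fun d =>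
      (s.metaExp_packet d _).trans (by rw [hlaw])] at hmix
  exact hmix.trans h

theorem Encoding.dependsOn (hs : s.IsUncoded) (h : s.Encoding PD) (hPD : ∀ d, PD d ≠ 0)
    {d : Demand K N} {z : ∀ k, s.CacheMeta k} {p : ∀ k, s.PacketMeta k}
    (hw : s.metaLaw d z p ≠ 0) (k : Fin K) :
    DependsOn (s.payloadBits k p) (hs.cacheBits k (z k) : Set (BitIndex N B)) := by
  set H : s.Metadata → ℝ := fun t => condEntropy (fair (BitIndex N B))
    (fun f => s.X k (s.outcomeEquiv.symm (t, f)))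
    (fun f => (s.packetMeta k (s.outcomeEquiv.symm (t, f)), s.Z k (s.outcomeEquiv.symm (t, f))))
  have hmix : ∑ t, s.fullLaw PD t * H t ≤ 0 :=
    (s.sum_fullLaw_mul_condEntropy_le PD (s.X k)
      (fun ω => (s.packetMeta k ω, s.Z k ω))).trans_eq (h k)
  have hterm : ∀ t ∈ univ, 0 ≤ s.fullLaw PD t * H t := fun t _ =>
    mul_nonneg (s.fullLaw_nonneg t) (condEntropy_nonneg fair_nonneg _ _)
  have hzero := (sum_eq_zero_iff_of_nonneg hterm).1 (le_antisymm hmix (sum_nonneg hterm))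
    (d, z, p) (mem_univ _)
  have hne : s.fullLaw PD (d, z, p) ≠ 0 :=
    mul_ne_zero (ENNReal.toReal_ne_zero.2 ⟨hPD d, PD.apply_ne_top d⟩) hw
  have hfactors := factorsThrough_of_condEntropy_eq_zero fair_pos
    ((mul_eq_zero.1 hzero).resolve_left hne)
  intro f g hfg
  have hcontent := (content_curry_eq_iff hs).2 (restrict_eq_restrict_iff.2 fun i hi => hfg i hi)
  exact (Prod.ext_iff.1 (hfactors (a := f) (b := g)
    (Prod.ext rfl (Prod.ext rfl hcontent)))).2

theorem Decoding.mul_metaExp_equivocation_le (hs : s.IsUncoded) {ε : ℝ} (h : s.Decoding PD ε)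
    (d : Demand K N) (k : Fin K) :
    (PD d).toReal * s.metaExp d (fun z p => equivocation (fun f j => s.payloadBits j p f)
      (hs.cacheBits k (z k)) (fileBits B (d k))) ≤ B * ε := by
  set E : Demand K N → (∀ k, s.CacheMeta k) → (∀ k, s.PacketMeta k) → ℝ := fun d z p =>
    equivocation (fun f j => s.payloadBits j p f) (hs.cacheBits k (z k)) (fileBits B (d k))
  have hE : ∀ t : s.Metadata, E t.1 t.2.1 t.2.2 ≤ condEntropy (fair (BitIndex N B))
      (fun f => s.F (s.D (s.outcomeEquiv.symm (t, f)) k) (s.outcomeEquiv.symm (t, f)))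
      (fun f => (s.allX (s.outcomeEquiv.symm (t, f)), s.Z k (s.outcomeEquiv.symm (t, f)),
        s.D (s.outcomeEquiv.symm (t, f)) k)) := fun t => by
    refine (condEntropy_mono fair_nonneg fun f g hfg => ?_).trans
      (condEntropy_anti fair_nonneg _ fun f g hfg => ?_)
    · refine restrict_eq_restrict_iff.2 fun i hi => ?_
      obtain ⟨n, b⟩ := i
      obtain rfl : t.1 k = n := by simpa [fileBits] using hi
      exact congrFun (Prod.ext_iff.1 hfg).1 b
    · obtain ⟨hV, hC⟩ := Prod.ext_iff.1 hfg
      exact Prod.ext (funext fun j => Prod.ext rfl (congrFun hV j))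
        (Prod.ext (Prod.ext rfl ((content_curry_eq_iff hs).2 hC)) rfl)
  have hmix := (s.sum_fullLaw_mul_condEntropy_le PD (fun ω => s.F (s.D ω k) ω)
    (fun ω => (s.allX ω, s.Z k ω, s.D ω k))).trans (h k)
  calc _ ≤ ∑ d, (PD d).toReal * s.metaExp d (E d) :=
        single_le_sum (f := fun d => (PD d).toReal * s.metaExp d (E d)) (fun d _ =>
          mul_nonneg ENNReal.toReal_nonneg (s.metaExp_nonneg fun _ _ => equivocation_nonneg _ _ _))
          (mem_univ d)
    _ = ∑ t, s.fullLaw PD t * E t.1 t.2.1 t.2.2 := (s.sum_fullLaw_mul E).symm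
    _ ≤ _ := (sum_le_sum fun t _ =>
        mul_le_mul_of_nonneg_left (hE t) (s.fullLaw_nonneg t)).trans hmix

theorem Decoding.meanError_le (hs : s.IsUncoded) {ε : ℝ} (h : s.Decoding PD ε) {d : Demand K N}
    (hd : PD d ≠ 0) : meanError hs d ≤ K * (B * ε * (PD d).toReal⁻¹) := by
  have hpos : 0 < (PD d).toReal := ENNReal.toReal_pos hd (PD.apply_ne_top d)
  unfold meanError totalError
  rw [s.metaExp_sum]
  refine (sum_le_card_nsmul _ _ (B * ε * (PD d).toReal⁻¹) fun k _ => ?_).trans_eq (by simp)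
  rw [← div_eq_mul_inv, le_div_iff₀ hpos, mul_comm]
  exact h.mul_metaExp_equivocation_le hs d k

theorem Decoding.meanError_le_mul_sum_inv (hs : s.IsUncoded) {ε : ℝ} (h : s.Decoding PD ε)
    (hPD : ∀ d, PD d ≠ 0) (hε : 0 ≤ ε) (d : Demand K N) :
    meanError hs d ≤ B * (K * (ε * ∑ d, (PD d).toReal⁻¹)) := by
  have hinv : (PD d).toReal⁻¹ ≤ ∑ d, (PD d).toReal⁻¹ :=
    single_le_sum (f := fun d => (PD d).toReal⁻¹)
      (fun d _ => inv_nonneg.2 ENNReal.toReal_nonneg) (mem_univ d)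
  calc meanError hs d ≤ K * (B * ε * (PD d).toReal⁻¹) := h.meanError_le hs (hPD d)
    _ ≤ K * (B * ε * ∑ d, (PD d).toReal⁻¹) := by gcongr
    _ = B * (K * (ε * ∑ d, (PD d).toReal⁻¹)) := by ring

end Constraints

end Scheme

namespace Scheme

/-! ### Privacy against single users -/

section Privacy

variable {K N B : ℕ} {s : Scheme K N B} {PD : PMF (Demand K N)}

/-- Privacy against single users: the signals together with the cache of any one user reveal
nothing about the demand vector beyond the demand of this user. -/
def UserPrivacy (s : Scheme K N B) (PD : PMF (Demand K N)) : Prop :=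
  ∀ k, condMutualInfo (s.prob PD) s.D (fun ω => (s.allX ω, s.Z k ω)) (fun ω => s.D ω k) = 0

theorem CollusionPrivacy.userPrivacy (h : s.CollusionPrivacy PD) : s.UserPrivacy PD := fun k => by
  have hk : k ∈ ({k} : Finset (Fin K)) := mem_singleton_self k
  rw [← condMutualInfo_congr_right s.prob_nonneg s.D _
    (Z := fun ω (j : ({k} : Finset (Fin K))) => s.D ω j)
    (fun _ _ e => congrFun e ⟨k, hk⟩) fun _ _ e => funext fun ⟨j, hj⟩ => by
      obtain rfl := mem_singleton.1 hj
      exact e]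
  refine condMutualInfo_eq_zero_of_factorsThrough s.prob_nonneg
    (h {k} (singleton_nonempty k)) fun _ _ e => ?_
  exact Prod.ext (Prod.ext_iff.1 e).1 (congrFun (Prod.ext_iff.1 e).2 ⟨k, hk⟩)

theorem mass_demand (s : Scheme K N B) (PD : PMF (Demand K N)) (d : Demand K N) :
    mass (s.prob PD) s.D d = (PD d).toReal := by
  classical
  refine (mass_comp_fst (g := Prod.fst) s.outcomeEquiv s.prob_eq sum_fair d).trans ?_
  simp only [mass, sum_filter, Fintype.sum_prod_type, fullLaw]
  rw [sum_eq_single d (fun d' _ hd' => by simp [hd']) (by simp)]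
  simp only [if_true, ← mul_sum, sum_metaLaw, sum_toReal_pmf, mul_one]

theorem mass_demand_packetMeta (s : Scheme K N B) (PD : PMF (Demand K N)) (d : Demand K N)
    (p : ∀ k, s.PacketMeta k) :
    mass (s.prob PD) (fun ω => (s.D ω, ω.2.2.2)) (d, p) = (PD d).toReal * s.packetLaw d p := by
  classical
  refine (mass_comp_fst (g := fun t : s.Metadata => (t.1, t.2.2)) s.outcomeEquiv s.prob_eq
    sum_fair (d, p)).trans ?_
  simp only [mass, sum_filter, Fintype.sum_prod_type, fullLaw, Prod.mk.injEq]
  rw [sum_eq_single d (fun d' _ hd' => by simp [hd']) (by simp), packetLaw, mul_sum]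
  refine sum_congr rfl fun z _ => ?_
  rw [sum_eq_single p (fun p' _ hp' => by simp [hp']) (by simp)]
  simp

theorem UserPrivacy.packetLaw_eq_of_apply_eq (h : s.UserPrivacy PD) (hPD : ∀ d, PD d ≠ 0)
    {k : Fin K} {d d' : Demand K N} (hk : d k = d' k) : s.packetLaw d = s.packetLaw d' := by
  have hind : condMutualInfo (s.prob PD) s.D (fun ω => ω.2.2.2) (fun ω => s.D ω k) = 0 :=
    condMutualInfo_eq_zero_of_factorsThrough s.prob_nonneg (h k) fun ω ω' e =>
      funext fun j => (Prod.ext_iff.1 (congrFun (Prod.ext_iff.1 e).1 j)).1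
  have hmarginal : ∀ d p, s.packetLaw d p * mass (s.prob PD) (fun ω => s.D ω k) (d k) =
      mass (s.prob PD) (fun ω => (ω.2.2.2, s.D ω k)) (p, d k) := fun d p => by
    have hmass := mass_mul_mass_comp_of_condMutualInfo_eq_zero s.prob_nonneg
      (g := fun d : Demand K N => d k) hind d p
    rw [mass_demand, mass_demand_packetMeta, mul_assoc] at hmass
    exact mul_left_cancel₀ (ENNReal.toReal_ne_zero.2 ⟨hPD d, PD.apply_ne_top d⟩) hmass
  have hpos : 0 < mass (s.prob PD) (fun ω => s.D ω k) (d k) :=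
    (ENNReal.toReal_pos (hPD d) (PD.apply_ne_top d)).trans_le <| by
      rw [← s.mass_demand PD d]
      exact mass_mono s.prob_nonneg fun ω e => congrFun e k
  funext p
  refine mul_right_cancel₀ hpos.ne' ?_
  rw [hmarginal, hk, hmarginal]

-- Two demand vectors are linked by a third one that agrees with each of them at one user.
theorem UserPrivacy.packetLaw_eq (h : s.UserPrivacy PD) (hPD : ∀ d, PD d ≠ 0) (hK : 2 ≤ K)
    (d d' : Demand K N) : s.packetLaw d = s.packetLaw d' := by
  obtain ⟨k₀, k₁, hne⟩ : ∃ k₀ k₁ : Fin K, k₀ ≠ k₁ := ⟨⟨0, by lia⟩, ⟨1, by lia⟩, by simp⟩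
  calc s.packetLaw d = s.packetLaw (Function.update d k₁ (d' k₁)) :=
        h.packetLaw_eq_of_apply_eq hPD (Function.update_of_ne hne _ _).symm
    _ = s.packetLaw d' := h.packetLaw_eq_of_apply_eq hPD (Function.update_self _ _ _)

end Privacy

end Scheme

/-! ### Two groups of users -/

section Regular

variable {ι σ : Type*} [DecidableEq ι] [Fintype σ] {m : ℕ}

theorem sum_card_inter_of_regular {F : σ → Finset ι} (hF : ∀ b, #{c | b ∈ F c} = m)
    (Q : Finset ι) : ∑ c, #(F c ∩ Q) = m * #Q := by
  calc ∑ c, #(F c ∩ Q) = ∑ c, #{b ∈ Q | b ∈ F c} := by simp only [filter_mem_eq_inter, inter_comm]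
    _ = ∑ b ∈ Q, #{c | b ∈ F c} := sum_card_bipartiteAbove_eq_sum_card_bipartiteBelow _
    _ = m * #Q := by simp only [hF, sum_const, smul_eq_mul, mul_comm]

theorem sum_sum_blockGain_of_regular {κ : Type*} [Fintype κ] [LinearOrder κ] [Fintype ι] (h : ℕ)
    {F : σ → κ → Finset ι} (hF : ∀ i b, #{c | b ∈ F c i} = m) (Q : Finset ι) :
    ∑ c, ∑ i, blockGain h (F c) i Q = Fintype.card κ * m *
      (bitWeight h (Fintype.card κ) * (Fintype.card ι - #Q) -
        overlapWeight h (Fintype.card κ) * (Fintype.card κ - 1) * #Q) := by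
  have hinter : ∀ i (Q : Finset ι), ∑ c, (#(F c i ∩ Q) : ℝ) = m * #Q := fun i Q => by
    exact_mod_cast sum_card_inter_of_regular (hF i) Q
  have hcard : ∀ i, ∑ c, (#(F c i) : ℝ) = m * Fintype.card ι := fun i => by
    simpa only [inter_univ, card_univ] using hinter i univ
  have hothers : ∀ i, ∑ c, ∑ j ∈ univ.erase i, (#(F c j ∩ Q) : ℝ) =
      (Fintype.card κ - 1) * (m * #Q) := fun i => by
    rw [sum_comm, sum_congr rfl fun j _ => hinter j Q, sum_const, nsmul_eq_mul,
      cast_card_erase_of_mem (mem_univ i), card_univ]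
  rw [sum_comm]
  simp only [blockGain, sum_sub_distrib, ← mul_sum, hcard, hinter, hothers, sum_const, card_univ,
    nsmul_eq_mul]
  ring

end Regular

/-- The bits of the demanded files. -/
def blockBits {K N : ℕ} (B : ℕ) (d : Demand K N) : Finset (BitIndex N B) := univ.image d ×ˢ univ

/-- Every demanded file is demanded by some user in the group `G`. -/
def DemandsAll {K N : ℕ} (G : Finset (Fin K)) (d : Demand K N) : Prop :=
  ∀ k, ∃ k' ∈ G, d k' = d k

theorem DemandsAll.blockBits_eq {K N B : ℕ} {G : Finset (Fin K)} {d : Demand K N}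
    (h : DemandsAll G d) : blockBits B d = G.biUnion fun k => fileBits B (d k) := by
  ext ⟨n, b⟩
  simp only [blockBits, fileBits, mem_product, mem_image, mem_univ, true_and, and_true, mem_biUnion,
    mem_singleton]
  constructor
  · rintro ⟨k, rfl⟩
    exact (h k).imp fun k' hk' => ⟨hk'.1, hk'.2.symm⟩
  · rintro ⟨k, -, rfl⟩
    exact ⟨k, rfl⟩

namespace Scheme

variable {K N B : ℕ} {s : Scheme K N B} {PD : PMF (Demand K N)}

section Groups

/-- The payloads of the users in the group `G`. -/
def groupPayload (s : Scheme K N B) (G : Finset (Fin K)) (p : ∀ k, s.PacketMeta k)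
    (f : BitIndex N B → Bool) (k : G) : List Bool := s.payloadBits k p f

/-- The bits that are cached by some user in the group `G`. -/
def groupCache (hs : s.IsUncoded) (G : Finset (Fin K)) (z : ∀ k, s.CacheMeta k) :
    Finset (BitIndex N B) := G.biUnion fun k => hs.cacheBits k (z k)

/-- The bits that are cached both in the group `G` and outside of it. -/
def commonCache (hs : s.IsUncoded) (G : Finset (Fin K)) (z : ∀ k, s.CacheMeta k) :
    Finset (BitIndex N B) := groupCache hs G z ∩ groupCache hs Gᶜ z

variable {hs : s.IsUncoded} {G : Finset (Fin K)} {z : ∀ k, s.CacheMeta k}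
  {p : ∀ k, s.PacketMeta k}

theorem groupCache_union_compl (hs : s.IsUncoded) (G : Finset (Fin K))
    (z : ∀ k, s.CacheMeta k) : groupCache hs G z ∪ groupCache hs Gᶜ z = groupCache hs univ z := by
  rw [groupCache, groupCache, ← union_biUnion, union_compl, groupCache]

theorem dependsOn_groupPayload
    (hdep : ∀ k, DependsOn (s.payloadBits k p) (hs.cacheBits k (z k) : Set (BitIndex N B)))
    (G : Finset (Fin K)) :
    DependsOn (s.groupPayload G p) (groupCache hs G z : Set (BitIndex N B)) := fun _ _ h =>
  funext fun k => hdep k fun i hi => h i (mem_biUnion.2 ⟨k, k.2, hi⟩)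

theorem equivocation_blockBits_le
    (hdep : ∀ k, DependsOn (s.payloadBits k p) (hs.cacheBits k (z k) : Set (BitIndex N B)))
    {d : Demand K N} (hd : DemandsAll Gᶜ d) :
    equivocation (s.groupPayload G p) (groupCache hs Gᶜ z) (blockBits B d) ≤
      totalError hs d z p := by
  have hall : (fun f (j : Fin K) => s.payloadBits j p f).FactorsThrough
      fun f => (s.groupPayload G p f, (groupCache hs Gᶜ z).restrict f) := fun f g h => by
    obtain ⟨hV, hC⟩ := Prod.ext_iff.1 h
    funext j
    by_cases hj : j ∈ G
    · exact congrFun hV ⟨j, hj⟩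
    · exact hdep j fun i hi => restrict_eq_restrict_iff.1 hC i
        (mem_biUnion.2 ⟨j, mem_compl.2 hj, hi⟩)
  rw [hd.blockBits_eq]
  calc _ ≤ ∑ k ∈ Gᶜ, equivocation (s.groupPayload G p) (groupCache hs Gᶜ z) (fileBits B (d k)) :=
        equivocation_biUnion_le _ _ _ _
    _ ≤ ∑ k ∈ Gᶜ, equivocation (fun f j => s.payloadBits j p f) (hs.cacheBits k (z k))
          (fileBits B (d k)) :=
        sum_le_sum fun k hk => equivocation_anti hall
          (subset_biUnion_of_mem (fun k => hs.cacheBits k (z k)) hk) _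
    _ ≤ totalError hs d z p :=
        sum_le_univ_sum_of_nonneg fun k => equivocation_nonneg _ _ _

theorem entropy_groupPayload_add_compl_le (G : Finset (Fin K)) (p : ∀ k, s.PacketMeta k) :
    entropy (fair (BitIndex N B)) (s.groupPayload G p) +
      entropy (fair (BitIndex N B)) (s.groupPayload Gᶜ p) ≤
        ∑ k, entropy (fair (BitIndex N B)) (s.payloadBits k p) := by
  rw [← sum_add_sum_compl G]
  exact add_le_add
    (entropy_tuple_le fair_nonneg sum_fair (fun k => s.payloadBits k p) G)
    (entropy_tuple_le fair_nonneg sum_fair (fun k => s.payloadBits k p) Gᶜ)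

/-! ### The load -/

theorem sum_blockGain_sub_totalError_le {κ : Type*} [Fintype κ] [LinearOrder κ] (h : ℕ)
    {dem : κ → Demand K N} (hG : ∀ i, DemandsAll G (dem i)) (hGc : ∀ i, DemandsAll Gᶜ (dem i))
    (hdisj : Pairwise (Disjoint on fun i => blockBits B (dem i)))
    {z : κ → ∀ k, s.CacheMeta k}
    (hdep : ∀ i k, DependsOn (s.payloadBits k p) (hs.cacheBits k (z i k) : Set (BitIndex N B))) :
    ∑ i, (blockGain h (fun i => blockBits B (dem i)) i (commonCache hs G (z i)) -
        (1 + overlapWeight h (Fintype.card κ) * Fintype.card κ) *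
          (2 * totalError hs (dem i) (z i) p)) ≤
      ∑ k, entropy (fair (BitIndex N B)) (s.payloadBits k p) := by
  refine le_trans (sum_le_sum fun i _ => ?_) ((sum_blockGain_sub_equivocation_le h hdisj
    (fun i => dependsOn_groupPayload (hdep i) G)
    fun i => dependsOn_groupPayload (hdep i) Gᶜ).trans (entropy_groupPayload_add_compl_le G p))
  have hw := overlapWeight_nonneg h (Nat.cast_nonneg (α := ℝ) (Fintype.card κ))
  have hGdec : equivocation (s.groupPayload Gᶜ p) (groupCache hs G (z i)) (blockBits B (dem i)) ≤
      totalError hs (dem i) (z i) p := by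
    simpa only [compl_compl] using equivocation_blockBits_le (G := Gᶜ) (hdep i)
      (by rw [compl_compl]; exact hG i)
  refine sub_le_sub le_rfl (mul_le_mul_of_nonneg_left ?_ (by positivity))
  rw [two_mul]
  exact add_le_add (equivocation_blockBits_le (hdep i) (hGc i)) hGdec

theorem sum_cacheExp_blockGain_sub_meanError_le {κ : Type*} [Fintype κ] [LinearOrder κ] {R ε : ℝ}
    (hs : s.IsUncoded) (henc : s.Encoding PD) (hpriv : s.UserPrivacy PD) (hload : s.Load PD R ε)
    (hPD : ∀ d, PD d ≠ 0) (hK : 2 ≤ K) (h : ℕ) {dem : κ → Demand K N}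
    (hG : ∀ i, DemandsAll G (dem i)) (hGc : ∀ i, DemandsAll Gᶜ (dem i))
    (hdisj : Pairwise (Disjoint on fun i => blockBits B (dem i))) :
    ∑ i, (s.cacheExp (fun z => blockGain h (fun i => blockBits B (dem i)) i (commonCache hs G z)) -
        (1 + overlapWeight h (Fintype.card κ) * Fintype.card κ) * (2 * meanError hs (dem i))) ≤
      B * (R + ε) := by
  set W := 1 + overlapWeight h (Fintype.card κ) * Fintype.card κ
  obtain ⟨d₀, -⟩ := PD.support_nonempty
  have hlaw : ∀ d, s.packetLaw d = s.packetLaw d₀ := fun d => hpriv.packetLaw_eq hPD hK d d₀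
  have hmeta : ∀ i, s.cacheExp (fun z => blockGain h (fun i => blockBits B (dem i)) i
      (commonCache hs G z)) - W * (2 * meanError hs (dem i)) =
        ∑ p, ∑ z, s.metaLaw (dem i) z p * (blockGain h (fun i => blockBits B (dem i)) i
          (commonCache hs G z) - W * (2 * totalError hs (dem i) z p)) := fun i => by
    rw [sum_comm, ← mul_assoc, meanError, ← s.metaExp_sub_const_mul]
    simp only [metaExp, mul_assoc]
  calc _ = ∑ p, ∑ i, ∑ z, s.metaLaw (dem i) z p * (blockGain h (fun i => blockBits B (dem i)) i
          (commonCache hs G z) - W * (2 * totalError hs (dem i) z p)) := by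
        rw [sum_congr rfl fun i _ => hmeta i, sum_comm]
    _ ≤ ∑ p, s.packetLaw d₀ p * ∑ k, entropy (fair (BitIndex N B)) (s.payloadBits k p) :=
        sum_le_sum fun p _ => sum_sum_mul_le_mul_of_forall_support
          (fun i z => s.metaLaw_nonneg (dem i) z p) (s.packetLaw_nonneg d₀ p)
          (fun i => congrFun (hlaw (dem i)) p) fun z hz =>
            sum_blockGain_sub_totalError_le h hG hGc hdisj fun i =>
              henc.dependsOn hs hPD (hz i)
    _ ≤ B * (R + ε) := hload.sum_packetLaw_mul_entropy_le hlaw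

/-! ### The common cache -/

theorem cacheExp_card_sdiff_groupCache_le (hs : s.IsUncoded) (henc : s.Encoding PD)
    (hPD : ∀ d, PD d ≠ 0) {d : Demand K N} (hd : DemandsAll Gᶜ d) :
    s.cacheExp (fun z => #(blockBits B d \ groupCache hs univ z)) ≤ meanError hs d := by
  rw [← s.metaExp_cache d]
  refine s.metaExp_mono_of_support fun z p hw => ?_
  have hdep := henc.dependsOn hs hPD hw
  rw [← groupCache_union_compl hs G]
  exact (card_sdiff_le_equivocation (dependsOn_groupPayload hdep G) subset_rfl).trans
    (equivocation_blockBits_le hdep hd)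

theorem card_commonCache_add_le (hs : s.IsUncoded) (G : Finset (Fin K))
    (z : ∀ k, s.CacheMeta k) :
    #(commonCache hs G z) + N * B ≤ ∑ k, #(hs.cacheBits k (z k)) + #(groupCache hs univ z)ᶜ := by
  have hbits : #(groupCache hs univ z) + #(groupCache hs univ z)ᶜ = N * B := by
    rw [card_add_card_compl, Fintype.card_prod, Fintype.card_fin, Fintype.card_fin]
  have hinter := card_union_add_card_inter (groupCache hs G z) (groupCache hs Gᶜ z)
  rw [groupCache_union_compl] at hinter
  have hG : ∀ G, #(groupCache hs G z) ≤ ∑ k ∈ G, #(hs.cacheBits k (z k)) := fun G =>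
    card_biUnion_le
  have := hG G
  have := hG Gᶜ
  have := sum_add_sum_compl G fun k => #(hs.cacheBits k (z k))
  rw [commonCache]
  lia

theorem cacheExp_card_commonCache_le {σ : Type*} [Fintype σ] {M ε : ℝ} (hs : s.IsUncoded)
    (hsize : s.CacheSize PD M ε) (henc : s.Encoding PD) (hPD : ∀ d, PD d ≠ 0)
    {dem : σ → Demand K N} (hGc : ∀ c, DemandsAll Gᶜ (dem c)) (hcov : ∀ n, ∃ c k, dem c k = n) :
    s.cacheExp (fun z => #(commonCache hs G z)) ≤
      K * (B * (M + ε)) - N * B + ∑ c, meanError hs (dem c) := by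
  have hpoint : ∀ z, (#(commonCache hs G z) : ℝ) ≤ (∑ k, (#(hs.cacheBits k (z k)) : ℝ) + -(N * B)) +
      ∑ c, (#(blockBits B (dem c) \ groupCache hs univ z) : ℝ) := fun z => by
    have hunion : (groupCache hs univ z)ᶜ ⊆
        univ.biUnion fun c => blockBits B (dem c) \ groupCache hs univ z := fun i hi => by
      obtain ⟨c, k, hck⟩ := hcov i.1
      refine mem_biUnion.2 ⟨c, mem_univ c, mem_sdiff.2 ⟨?_, mem_compl.1 hi⟩⟩
      exact mem_product.2 ⟨mem_image.2 ⟨k, mem_univ k, hck⟩, mem_univ _⟩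
    have hle := (card_commonCache_add_le hs G z).trans
      (Nat.add_le_add_left ((card_le_card hunion).trans card_biUnion_le) _)
    have hle' : (#(commonCache hs G z) : ℝ) + N * B ≤ ∑ k, (#(hs.cacheBits k (z k)) : ℝ) +
      ∑ c, (#(blockBits B (dem c) \ groupCache hs univ z) : ℝ) := by exact_mod_cast hle
    linarith
  refine (s.cacheExp_mono hpoint).trans ?_
  rw [cacheExp_add, cacheExp_add, cacheExp_sum, cacheExp_sum, cacheExp_const, ← sub_eq_add_neg]
  refine add_le_add (sub_le_sub_right ?_ _) (sum_le_sum fun c _ =>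
    cacheExp_card_sdiff_groupCache_le hs henc hPD (hGc c))
  exact (sum_le_card_nsmul _ _ _ fun k _ => hsize.cacheExp_card_le hs k).trans_eq (by simp)

end Groups

end Scheme

/-! ### Averaging over demands -/

/-- The weighted gain per file that `t` disjoint blocks of files guarantee when the fraction `u` of
the library is cached in both groups of users, for the parameter `h` of the affine minorant. -/
def blockRate (h : ℕ) (u t : ℝ) : ℝ :=
  bitWeight h t * (1 - u) - overlapWeight h t * (t - 1) * u

theorem antitone_blockRate (h : ℕ) {t : ℝ} (ht : 1 ≤ t) : Antitone fun u => blockRate h u t := by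
  intro u v huv
  have ht0 : 0 ≤ t := zero_le_one.trans ht
  have hslope := mul_nonneg (overlapWeight_nonneg h ht0) (sub_nonneg.2 ht)
  exact sub_le_sub (mul_le_mul_of_nonneg_left (sub_le_sub_left huv 1) (bitWeight_nonneg h ht0))
    (mul_le_mul_of_nonneg_left huv hslope)

theorem antitoneOn_blockRate (h : ℕ) {u : ℝ} (hu0 : 0 ≤ u) (hu1 : u ≤ 1) :
    AntitoneOn (blockRate h u) (Set.Ioi 0) := by
  intro a (ha : 0 < a) b (hb : 0 < b) hab
  have hdiff : blockRate h u a - blockRate h u b =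
      (b - a) * ((h + 1) * h * (1 - u) + 2 * h * u + u * a * b) /
        ((h + 1) * (h + 2) * (a * b)) := by
    unfold blockRate bitWeight overlapWeight
    field_simp
    ring
  have : 0 ≤ 1 - u := sub_nonneg.2 hu1
  have : 0 ≤ b - a := sub_nonneg.2 hab
  rw [← sub_nonneg, hdiff]
  positivity

namespace Scheme

section Average

variable {K N B m : ℕ} {s : Scheme K N B} {PD : PMF (Demand K N)} {R M ε : ℝ} {G : Finset (Fin K)}
  {κ : Type*} [Fintype κ] [LinearOrder κ]

theorem gain_sub_meanError_le_of_regular {σ : Type*} [Fintype σ] (hs : s.IsUncoded)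
    (henc : s.Encoding PD) (hpriv : s.UserPrivacy PD) (hload : s.Load PD R ε)
    (hPD : ∀ d, PD d ≠ 0) (hK : 2 ≤ K) (h : ℕ) {dem : σ → κ → Demand K N}
    (hG : ∀ c i, DemandsAll G (dem c i)) (hGc : ∀ c i, DemandsAll Gᶜ (dem c i))
    (hdisj : ∀ c, Pairwise (Disjoint on fun i => blockBits B (dem c i)))
    (hreg : ∀ i x, #{c | x ∈ blockBits B (dem c i)} = m) :
    Fintype.card κ * m *
        (bitWeight h (Fintype.card κ) * (N * B - s.cacheExp fun z => #(commonCache hs G z)) -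
          overlapWeight h (Fintype.card κ) * (Fintype.card κ - 1) *
            s.cacheExp fun z => #(commonCache hs G z)) -
      (1 + overlapWeight h (Fintype.card κ) * Fintype.card κ) *
        (2 * ∑ c, ∑ i, meanError hs (dem c i)) ≤ Fintype.card σ * (B * (R + ε)) := by
  set w := bitWeight h (Fintype.card κ)
  set o := overlapWeight h (Fintype.card κ)
  set q := s.cacheExp fun z => #(commonCache hs G z)
  have hgain : ∑ c, ∑ i, s.cacheExp (fun z =>
      blockGain h (fun i => blockBits B (dem c i)) i (commonCache hs G z)) =
        Fintype.card κ * m * (w * (N * B - q) - o * (Fintype.card κ - 1) * q) := by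
    have hpoint : ∀ z, ∑ c, ∑ i, blockGain h (fun i => blockBits B (dem c i)) i
        (commonCache hs G z) = Fintype.card κ * m * w * (N * B) +
          -(Fintype.card κ * m * (w + o * (Fintype.card κ - 1))) * #(commonCache hs G z) :=
      fun z => by
        rw [sum_sum_blockGain_of_regular h hreg]
        simp only [Fintype.card_prod, Fintype.card_fin, Nat.cast_mul]
        ring
    simp only [← cacheExp_sum, hpoint]
    rw [cacheExp_add, cacheExp_const, cacheExp_const_mul]
    ring
  have hsum := sum_le_card_nsmul univ _ _ fun c _ =>
    sum_cacheExp_blockGain_sub_meanError_le hs henc hpriv hload hPD hK h (hG c) (hGc c) (hdisj c)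
  simp only [sum_sub_distrib, hgain, ← mul_sum] at hsum
  rwa [card_univ, nsmul_eq_mul] at hsum

theorem cacheExp_card_commonCache_div_le {σ : Type*} [Fintype σ] (hN : 0 < N) (hB : 0 < B)
    (hs : s.IsUncoded) (hsize : s.CacheSize PD M ε) (henc : s.Encoding PD) (hPD : ∀ d, PD d ≠ 0)
    {dem : σ → Demand K N} (hGc : ∀ c, DemandsAll Gᶜ (dem c)) (hcov : ∀ n, ∃ c k, dem c k = n)
    {η : ℝ} (hη : ∀ d, meanError hs d ≤ B * η) :
    (s.cacheExp fun z => #(commonCache hs G z)) / (N * B) ≤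
      (K * (M + ε) - N) / N + Fintype.card σ / N * η := by
  rw [div_le_iff₀ (by positivity)]
  refine (cacheExp_card_commonCache_le hs hsize henc hPD hGc hcov).trans
    ((add_le_add le_rfl (sum_le_card_nsmul _ _ _ fun c _ => hη _)).trans_eq ?_)
  rw [card_univ, nsmul_eq_mul]
  field_simp

theorem mul_blockRate_sub_le [Nonempty κ] (hN : 0 < N) (hB : 0 < B) (hm : 0 < m)
    (hs : s.IsUncoded) (hsize : s.CacheSize PD M ε) (henc : s.Encoding PD)
    (hpriv : s.UserPrivacy PD) (hload : s.Load PD R ε) (hPD : ∀ d, PD d ≠ 0) (hK : 2 ≤ K) (h : ℕ)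
    {dem : Fin N → κ → Demand K N} (hG : ∀ c i, DemandsAll G (dem c i))
    (hGc : ∀ c i, DemandsAll Gᶜ (dem c i))
    (hdisj : ∀ c, Pairwise (Disjoint on fun i => univ.image (dem c i)))
    (hreg : ∀ i x, #{c | x ∈ univ.image (dem c i)} = m)
    {η : ℝ} (hη : ∀ d, meanError hs d ≤ B * η) :
    m * Fintype.card κ * blockRate h ((K * (M + ε) - N) / N + η) (Fintype.card κ) -
      Fintype.card κ * (1 + overlapWeight h (Fintype.card κ) * Fintype.card κ) * (2 * η) ≤
        R + ε := by
  have hgain := gain_sub_meanError_le_of_regular hs henc hpriv hload hPD hK h hG hGc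
    (fun c i j hij => disjoint_product.2 (.inl (hdisj c hij)))
    (fun i x => by simpa [blockBits] using hreg i x.1)
  rw [Fintype.card_fin] at hgain
  have hcard : (1 : ℝ) ≤ Fintype.card κ := by exact_mod_cast Fintype.card_pos (α := κ)
  set t := (Fintype.card κ : ℝ)
  set q := s.cacheExp fun z => #(commonCache hs G z)
  have hNB : (0 : ℝ) < N * B := by positivity
  have hW := overlapWeight_nonneg h (zero_le_one.trans hcard)
  have herr : ∑ c, ∑ i, meanError hs (dem c i) ≤ N * B * (t * η) := by
    refine (sum_le_card_nsmul _ _ _ fun c _ => sum_le_card_nsmul _ _ _ fun i _ => hη _).trans_eq ?_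
    rw [card_univ, card_univ, Fintype.card_fin, nsmul_eq_mul, nsmul_eq_mul]
    ring
  have hq : q / (N * B) ≤ (K * (M + ε) - N) / N + η := by
    obtain ⟨i⟩ := ‹Nonempty κ›
    have hcov : ∀ n, ∃ c k, dem c i k = n := fun n => by
      obtain ⟨c, hc⟩ := card_pos.1 (hm.trans_eq (hreg i n).symm)
      exact ⟨c, by simpa using hc⟩
    simpa [hN.ne'] using cacheExp_card_commonCache_div_le hN hB hs hsize henc hPD
      (fun c => hGc c i) hcov hη
  have hrate : t * m * (bitWeight h t * (N * B - q) - overlapWeight h t * (t - 1) * q) =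
      N * B * (m * t * blockRate h (q / (N * B)) t) := by
    unfold blockRate
    field_simp
  refine le_of_mul_le_mul_left ?_ hNB
  calc _ = N * B * (m * t * blockRate h ((K * (M + ε) - N) / N + η) t) -
        (1 + overlapWeight h t * t) * (2 * (N * B * (t * η))) := by ring
    _ ≤ N * B * (m * t * blockRate h (q / (N * B)) t) -
        (1 + overlapWeight h t * t) * (2 * ∑ c, ∑ i, meanError hs (dem c i)) := by
      gcongr
      exact antitone_blockRate h hcard hq
    _ ≤ N * B * (R + ε) := by
      rw [← hrate, mul_assoc (N : ℝ)]
      exact hgain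

end Average

end Scheme

/-! ### Demands of disjoint blocks of files -/

section Demands

variable {K N m : ℕ}

theorem mul_add_lt_of_mul_le {n t a : ℕ} (hmn : n * m ≤ N) (ht : t < n) (ha : a < m) :
    t * m + a < N := by
  have : (t + 1) * m ≤ n * m := Nat.mul_le_mul_right m ht
  rw [add_mul, one_mul] at this
  lia

variable [NeZero N]

/-- The demand vector of the `t`-th block of `m` consecutive files, shifted cyclically by `c`:
user `k` demands the file `c + t * m + k % m`, modulo `N`. -/
def shiftDemand (K m : ℕ) (c : Fin N) (t : ℕ) : Demand K N :=
  fun k => c + Fin.ofNat N (t * m + k % m)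

theorem ofNat_injOn : Set.InjOn (Fin.ofNat N) (Set.Iio N) := fun a ha b hb h => by
  have := congrArg Fin.val h
  simpa [Fin.ofNat, Nat.mod_eq_of_lt ha, Nat.mod_eq_of_lt hb] using this

theorem exists_shiftDemand_eq_iff (hm : 0 < m) (hmK : m ≤ K) {c x : Fin N} {t : ℕ} :
    (∃ k, shiftDemand K m c t k = x) ↔ ∃ a : Fin m, c + Fin.ofNat N (t * m + a) = x := by
  constructor
  · rintro ⟨k, hk⟩
    exact ⟨⟨k % m, Nat.mod_lt _ hm⟩, hk⟩
  · rintro ⟨a, ha⟩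
    exact ⟨⟨a, a.2.trans_le hmK⟩, by simpa [shiftDemand, Nat.mod_eq_of_lt a.2] using ha⟩

theorem card_mem_image_shiftDemand {n t : ℕ} (hm : 0 < m) (hmK : m ≤ K) (hmn : n * m ≤ N)
    (ht : t < n) (x : Fin N) : #{c | x ∈ univ.image (shiftDemand K m c t)} = m := by
  have hshifts : ({c | x ∈ univ.image (shiftDemand K m c t)} : Finset (Fin N)) =
      univ.image fun a : Fin m => x - Fin.ofNat N (t * m + a) := by
    ext c
    simp only [mem_filter, mem_univ, true_and, mem_image, exists_shiftDemand_eq_iff hm hmK]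
    exact exists_congr fun a => ⟨fun h => by rw [← h, add_sub_cancel_right],
      fun h => by rw [← h, sub_add_cancel]⟩
  have hinj : Function.Injective fun a : Fin m => x - Fin.ofNat N (t * m + a) := fun a b h =>
    Fin.ext <| Nat.add_left_cancel <| ofNat_injOn (mul_add_lt_of_mul_le hmn ht a.2)
      (mul_add_lt_of_mul_le hmn ht b.2) (sub_right_injective h)
  rw [hshifts, card_image_of_injective _ hinj, card_univ, Fintype.card_fin]

theorem pairwise_disjoint_image_shiftDemand {n : ℕ} (hm : 0 < m) (hmn : n * m ≤ N) (c : Fin N) :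
    Pairwise (Disjoint on fun t : Fin n => univ.image (shiftDemand K m c t)) := by
  intro t t' ht
  simp only [Function.onFun, disjoint_left, mem_image, mem_univ, true_and]
  rintro _ ⟨k, rfl⟩ ⟨k', hk'⟩
  have hpos : t' * m + k' % m = t * m + k % m :=
    ofNat_injOn (mul_add_lt_of_mul_le hmn t'.2 (Nat.mod_lt k' hm))
      (mul_add_lt_of_mul_le hmn t.2 (Nat.mod_lt k hm)) (add_left_cancel hk')
  have hblock : (t' : ℕ) = t := by
    simpa [add_comm _ (_ % m), Nat.add_mul_div_right _ _ hm, Nat.div_eq_of_lt (Nat.mod_lt _ hm)]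
      using congrArg (· / m) hpos
  exact ht (Fin.ext hblock.symm)

theorem demandsAll_shiftDemand (hm : 0 < m) (hmK : m ≤ K) (c : Fin N) (t : ℕ) :
    DemandsAll {k | (k : ℕ) < m} (shiftDemand K m c t) := fun k => by
  have hk := Nat.mod_lt k hm
  exact ⟨⟨k % m, by lia⟩, by simpa using hk, by simp [shiftDemand]⟩

theorem demandsAll_compl_shiftDemand (hm : 0 < m) (hmK : 2 * m ≤ K) (c : Fin N) (t : ℕ) :
    DemandsAll ({k | (k : ℕ) < m} : Finset (Fin K))ᶜ (shiftDemand K m c t) := fun k => by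
  have hk := Nat.mod_lt k hm
  exact ⟨⟨k % m + m, by lia⟩, by simp, by simp [shiftDemand]⟩

end Demands

/-! ### Achievable loads -/

section Achievable

open Filter Topology

variable {K N : ℕ} {PD : PMF (Demand K N)} {M R : ℝ}

/-- The load `R` is achievable with cache size `M`, under uncoded cache placement and privacy
against single users: `AchievableUC` with the weaker privacy constraint. -/
def AchievableU (K N : ℕ) (PD : PMF (Demand K N)) (M R : ℝ) : Prop :=
  ∃ ε : ℕ → ℝ, (∀ B, 0 ≤ ε B) ∧ Tendsto ε atTop (𝓝 0) ∧
    ∀ᶠ B in atTop, ∃ s : Scheme K N B,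
      s.IsUncoded ∧ s.CacheSize PD M (ε B) ∧ s.Encoding PD ∧ s.Decoding PD (ε B) ∧
        s.UserPrivacy PD ∧ s.Load PD R (ε B)

/-- The optimal load under privacy against single users (`⊤` if no load is achievable). -/
def optimalLoadU (K N : ℕ) (PD : PMF (Demand K N)) (M : ℝ) : EReal :=
  sInf {r : EReal | ∃ R : ℝ, AchievableU K N PD M R ∧ r = (R : EReal)}

theorem AchievableUC.achievableU (hR : AchievableUC K N PD M R) : AchievableU K N PD M R := by
  obtain ⟨ε, hε0, hε, hev⟩ := hR
  exact ⟨ε, hε0, hε, hev.mono fun B ⟨s, hs, hsize, henc, hdec, hpriv, hload⟩ =>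
    ⟨s, hs, hsize, henc, hdec, hpriv.userPrivacy, hload⟩⟩

theorem optimalLoadU_le_optimalLoadUC : optimalLoadU K N PD M ≤ optimalLoadUC K N PD M :=
  sInf_le_sInf fun _ ⟨R, hR, hr⟩ => ⟨R, hR.achievableU, hr⟩

theorem coe_le_optimalLoadU {x : ℝ} (hx : ∀ R, AchievableU K N PD M R → x ≤ R) :
    (x : EReal) ≤ optimalLoadU K N PD M := by
  refine le_sInf ?_
  rintro _ ⟨R, hR, rfl⟩
  exact EReal.coe_le_coe_iff.2 (hx R hR)

theorem AchievableU.mul_blockRate_le (hR : AchievableU K N PD M R) (hN : 0 < N) (hK : 2 ≤ K)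
    (hPD : ∀ d, PD d ≠ 0) {m n : ℕ} (hm : 0 < m) (hn : 0 < n) (hmK : 2 * m ≤ K)
    (hmn : n * m ≤ N) (h : ℕ) : m * n * blockRate h ((K * M - N) / N) n ≤ R := by
  have : NeZero N := ⟨hN.ne'⟩
  have : NeZero n := ⟨hn.ne'⟩
  obtain ⟨ε, hε0, hε, hev⟩ := hR
  set η : ℝ → ℝ := fun e => K * (e * ∑ d, (PD d).toReal⁻¹) with hη
  set f : ℝ → ℝ := fun e => m * n * blockRate h ((K * (M + e) - N) / N + η e) n -
    n * (1 + overlapWeight h n * n) * (2 * η e) with hf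
  have hfε : Tendsto (fun B => f (ε B)) atTop (𝓝 (f 0)) := by
    have hc : Continuous f := by unfold f η blockRate; fun_prop
    exact (hc.tendsto 0).comp hε
  have hle : ∀ᶠ B in atTop, f (ε B) ≤ R + ε B := by
    filter_upwards [hev, eventually_gt_atTop 0] with B ⟨s, hs, hsize, henc, hdec, hpriv, hload⟩ hB
    have hrate := Scheme.mul_blockRate_sub_le (κ := Fin n) hN hB hm hs hsize henc hpriv hload hPD
      hK h (dem := fun c t => shiftDemand K m c t)
      (fun c t => demandsAll_shiftDemand hm (by lia) c t)
      (fun c t => demandsAll_compl_shiftDemand hm hmK c t)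
      (pairwise_disjoint_image_shiftDemand hm hmn)
      (fun t => card_mem_image_shiftDemand hm (by lia) hmn t.2)
      (hdec.meanError_le_mul_sum_inv hs hPD (hε0 B))
    simpa only [Fintype.card_fin] using hrate
  simpa [hf, hη] using le_of_tendsto_of_tendsto hfε (tendsto_const_nhds.add hε) hle

end Achievable

/-! ### The three bounds -/

theorem mul_blockRate_two_mul_div {K N : ℝ} (hK : 0 < K) (hN : 0 < N) (h : ℕ) (y : ℝ) :
    N * blockRate h (2 * y / N) (2 * N / K) =
      N - 2 * y - (4 * y + (N - K / 2) * h) / (h + 2) +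
        (h ^ 2 * (N - K / 2) - N * (2 * N / K - 3) + h * (N + K / 2)) /
          ((h + 1) * (h + 2)) * (2 * y / N) := by
  unfold blockRate bitWeight overlapWeight
  field_simp
  ring

theorem floor_div_ceil_mul_le {x g R : ℝ} (hx : 0 < x) (hR : 0 ≤ R) (hg : ⌊x⌋ * g ≤ R) :
    (⌊x⌋ : ℝ) / ⌈x⌉ * (x * g) ≤ R := by
  have hceil : x ≤ ⌈x⌉ := Int.le_ceil x
  have hceil0 : (0 : ℝ) < ⌈x⌉ := hx.trans_le hceil
  calc (⌊x⌋ : ℝ) / ⌈x⌉ * (x * g) = x / ⌈x⌉ * (⌊x⌋ * g) := by ring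
    _ ≤ x / ⌈x⌉ * R := mul_le_mul_of_nonneg_left hg (by positivity)
    _ ≤ R := mul_le_of_le_one_left hR ((div_le_one hceil0).2 hceil)

theorem floor_natCast_div_two (K : ℕ) : (⌊(K : ℝ) / 2⌋ : ℝ) = (K / 2 : ℕ) := by
  rw [← natCast_floor_eq_intCast_floor (by positivity), Nat.floor_div_ofNat, Nat.floor_natCast]

theorem floor_two_mul_div_mul_le (K N : ℕ) : ⌊2 * (N : ℝ) / K⌋₊ * (K / 2) ≤ N := by
  rcases K.eq_zero_or_pos with rfl | hK
  · simp
  have hreal : (⌊2 * (N : ℝ) / K⌋₊ : ℝ) * (K / 2 : ℕ) ≤ N := by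
    calc (⌊2 * (N : ℝ) / K⌋₊ : ℝ) * (K / 2 : ℕ) ≤ 2 * N / K * (K / 2) := by
          gcongr
          · exact Nat.floor_le (by positivity)
          · exact Nat.cast_div_le
      _ = N := by field_simp
  exact_mod_cast hreal

theorem AchievableU.floor_div_ceil_mul_blockRate_le {K N : ℕ} {PD : PMF (Demand K N)} {M R : ℝ}
    (hR : AchievableU K N PD M R) (hK : 2 ≤ K) (hPD : ∀ d, PD d ≠ 0) (hM : K * M ≤ 2 * N)
    {n : ℕ} (hn : 0 < n) (hmn : n * (K / 2) ≤ N) (h : ℕ) :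
    (⌊(K : ℝ) / 2⌋ : ℝ) / ⌈(K : ℝ) / 2⌉ *
      ((K : ℝ) / 2 * (n * blockRate h ((K * M - N) / N) n)) ≤ R := by
  have hm : 0 < K / 2 := Nat.div_pos hK two_pos
  have hmN : K / 2 ≤ N := (Nat.le_mul_of_pos_left _ hn).trans hmn
  have hN : 0 < N := hm.trans_le hmN
  have hblock : ∀ {n h : ℕ}, 0 < n → n * (K / 2) ≤ N →
      ⌊(K : ℝ) / 2⌋ * (n * blockRate h ((K * M - N) / N) n) ≤ R := fun hn hmn => by
    rw [floor_natCast_div_two, ← mul_assoc]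
    exact hR.mul_blockRate_le hN hK hPD hm hn (Nat.mul_div_le K 2) hmn _
  have hone : blockRate 0 ((K * M - N) / N) 1 = (2 * N - K * M) / N := by
    unfold blockRate bitWeight overlapWeight
    field_simp
    ring
  have hR0 : 0 ≤ R := le_trans (by
    rw [Nat.cast_one, hone, floor_natCast_div_two]
    have := sub_nonneg.2 hM
    positivity) (hblock (h := 0) one_pos (by rwa [one_mul]))
  exact floor_div_ceil_mul_le (by positivity) hR0 (hblock hn hmn)

theorem AchievableU.floor_div_ceil_mul_floor_div_mul_blockRate_le {K N : ℕ}
    {PD : PMF (Demand K N)} {M R : ℝ} (hR : AchievableU K N PD M R) (hK : 2 ≤ K) (hKN : K ≤ N)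
    (hPD : ∀ d, PD d ≠ 0) (hNM : N ≤ K * M) (hMN : K * M ≤ 2 * N) (h : ℕ) :
    (⌊(K : ℝ) / 2⌋ : ℝ) / ⌈(K : ℝ) / 2⌉ * ((⌊2 * (N : ℝ) / K⌋ : ℝ) / (2 * N / K)) *
      (N * blockRate h ((K * M - N) / N) (2 * N / K)) ≤ R := by
  have hK0 : (0 : ℝ) < K := by exact_mod_cast two_pos.trans_le hK
  have hKN' : (K : ℝ) ≤ N := by exact_mod_cast hKN
  have hN0 : (0 : ℝ) < N := hK0.trans_le hKN'
  have hT : 1 ≤ 2 * (N : ℝ) / K := by rw [one_le_div hK0]; linarith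
  have hn : 0 < ⌊2 * (N : ℝ) / K⌋₊ := Nat.floor_pos.2 hT
  have hanti := antitoneOn_blockRate h (div_nonneg (sub_nonneg.2 hNM) hN0.le)
    ((div_le_one hN0).2 (by linarith)) (Set.mem_Ioi.2 (Nat.cast_pos.2 hn))
    (Set.mem_Ioi.2 (zero_lt_one.trans_le hT)) (Nat.floor_le (zero_le_one.trans hT))
  have hratio : (0 : ℝ) ≤ ⌊(K : ℝ) / 2⌋ / ⌈(K : ℝ) / 2⌉ :=
    div_nonneg (Int.cast_nonneg (Int.floor_nonneg.2 (by positivity)))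
      (Int.cast_nonneg (Int.ceil_nonneg (by positivity)))
  refine le_trans ?_ (hR.floor_div_ceil_mul_blockRate_le hK hPD hMN hn
    (floor_two_mul_div_mul_le K N) h)
  rw [← natCast_floor_eq_intCast_floor (zero_le_one.trans hT), mul_assoc]
  refine mul_le_mul_of_nonneg_left ?_ hratio
  calc _ = (K : ℝ) / 2 * (⌊2 * (N : ℝ) / K⌋₊ * blockRate h ((K * M - N) / N) (2 * N / K)) := by
        field_simp
    _ ≤ _ := by gcongr

end D2D

end

theorem theorem5_general (K N : ℕ) (hK : 2 ≤ K) (hKN : K ≤ N)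
    (PD : PMF (D2D.Demand K N)) (hPD : ∀ d : D2D.Demand K N, PD d ≠ 0)
    (y M : ℝ) (hy : y ∈ Set.Icc (0 : ℝ) ((N : ℝ) / 2))
    (hM : M = (N : ℝ) / (K : ℝ) + 2 * y / (K : ℝ)) :
    (∀ h : ℕ,
      (((⌊(K : ℝ) / 2⌋ : ℝ) / (⌈(K : ℝ) / 2⌉ : ℝ) *
          ((⌊2 * (N : ℝ) / (K : ℝ)⌋ : ℝ) / (2 * (N : ℝ) / (K : ℝ))) *
          ((N : ℝ) - 2 * y - (4 * y + ((N : ℝ) - (K : ℝ) / 2) * (h : ℝ)) / ((h : ℝ) + 2) +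
            ((h : ℝ) ^ 2 * ((N : ℝ) - (K : ℝ) / 2) - (N : ℝ) * (2 * (N : ℝ) / (K : ℝ) - 3) +
                (h : ℝ) * ((N : ℝ) + (K : ℝ) / 2)) /
              (((h : ℝ) + 1) * ((h : ℝ) + 2)) * (2 * y / (N : ℝ))) : ℝ) : EReal) ≤
        D2D.optimalLoadU K N PD M) ∧
    (((⌊(K : ℝ) / 2⌋ : ℝ) / (⌈(K : ℝ) / 2⌉ : ℝ) *
        ((K : ℝ) * (1 - 3 * y / (N : ℝ))) : ℝ) : EReal) ≤ D2D.optimalLoadU K N PD M ∧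
    (((⌊(K : ℝ) / 2⌋ : ℝ) / (⌈(K : ℝ) / 2⌉ : ℝ) *
        ((K : ℝ) * (1 / 2 - y / (N : ℝ))) : ℝ) : EReal) ≤ D2D.optimalLoadU K N PD M := by
  have hK0 : (0 : ℝ) < K := by exact_mod_cast two_pos.trans_le hK
  have hN0 : (0 : ℝ) < N := by exact_mod_cast (two_pos.trans_le hK).trans_le hKN
  have hKM : K * M = N + 2 * y := by rw [hM]; field_simp
  have hu : (K * M - N) / N = 2 * y / N := by rw [hKM, add_sub_cancel_left]
  have hMN : K * M ≤ 2 * N := by linarith [hy.2]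
  refine ⟨fun h => D2D.coe_le_optimalLoadU fun R hR => ?_,
    D2D.coe_le_optimalLoadU fun R hR => ?_, D2D.coe_le_optimalLoadU fun R hR => ?_⟩
  · rw [← D2D.mul_blockRate_two_mul_div hK0 hN0, ← hu]
    exact hR.floor_div_ceil_mul_floor_div_mul_blockRate_le hK hKN hPD (by linarith [hy.1]) hMN h
  · convert hR.floor_div_ceil_mul_blockRate_le hK hPD hMN two_pos (by lia) 0 using 2
    rw [hu, D2D.blockRate, D2D.bitWeight, D2D.overlapWeight]
    ring
  · convert hR.floor_div_ceil_mul_blockRate_le hK hPD hMN one_pos (by lia) 0 using 2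
    rw [hu, D2D.blockRate, D2D.bitWeight, D2D.overlapWeight]
    ring

theorem theorem5 (K N : ℕ) (hK : 3 ≤ K) (hKN : K ≤ N)
    (PD : PMF (D2D.Demand K N)) (hPD : ∀ d : D2D.Demand K N, PD d ≠ 0)
    (y M : ℝ) (hy : y ∈ Set.Icc (0 : ℝ) ((N : ℝ) / 2))
    (hM : M = (N : ℝ) / (K : ℝ) + 2 * y / (K : ℝ)) :
    (∀ h : ℕ, (h : ℤ) ≤ ⌊2 * (N : ℝ) / (K : ℝ) - 3⌋ →
      (((⌊(K : ℝ) / 2⌋ : ℝ) / (⌈(K : ℝ) / 2⌉ : ℝ) *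
          ((⌊2 * (N : ℝ) / (K : ℝ)⌋ : ℝ) / (2 * (N : ℝ) / (K : ℝ))) *
          ((N : ℝ) - 2 * y - (4 * y + ((N : ℝ) - (K : ℝ) / 2) * (h : ℝ)) / ((h : ℝ) + 2) +
            ((h : ℝ) ^ 2 * ((N : ℝ) - (K : ℝ) / 2) - (N : ℝ) * (2 * (N : ℝ) / (K : ℝ) - 3) +
                (h : ℝ) * ((N : ℝ) + (K : ℝ) / 2)) /
              (((h : ℝ) + 1) * ((h : ℝ) + 2)) * (2 * y / (N : ℝ))) : ℝ) : EReal) ≤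
        D2D.optimalLoadUC K N PD M) ∧
    (((⌊(K : ℝ) / 2⌋ : ℝ) / (⌈(K : ℝ) / 2⌉ : ℝ) *
        ((K : ℝ) * (1 - 3 * y / (N : ℝ))) : ℝ) : EReal) ≤ D2D.optimalLoadUC K N PD M ∧
    (((⌊(K : ℝ) / 2⌋ : ℝ) / (⌈(K : ℝ) / 2⌉ : ℝ) *
        ((K : ℝ) * (1 / 2 - y / (N : ℝ))) : ℝ) : EReal) ≤ D2D.optimalLoadUC K N PD M := by
  have hle : D2D.optimalLoadU K N PD M ≤ D2D.optimalLoadUC K N PD M :=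
    D2D.optimalLoadU_le_optimalLoadUC
  obtain ⟨hfamily, htwo, hone⟩ := theorem5_general K N (by lia) hKN PD hPD y M hy hM
  exact ⟨fun h _ => (hfamily h).trans hle, htwo.trans hle, hone.trans hle⟩
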